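/- Let $\Gamma_d$ be the Cayley graph of the symmetric group $S(d)$ generated by all transpositions ($\rho$ and $\sigma$ are adjacent iff $\sigma=\rho\,(i\ j)$ for a transposition $(i\ j)$), the edge corresponding to $(i\ j)$, $i<j$, being labelled by $j$. A walk on $\Gamma_d$ is monotone if the labels of the edges it traverses form a weakly increasing sequence. For a partition $\alpha\vdash d$ let $m^r(\alpha)$ be the number of $r$-step monotone walks on $\Gamma_d$ from the identity to a fixed permutation of cycle type $\alpha$, and let $M_\alpha(x)=\sum_{r\ge 0}m^r(\alpha)x^r$. Order the partitions of $d$ lexicographically as nondecreasing sequences of positive integers, with $1$ the first letter of the alphabet; let $\alpha^+$ denote the successor of $\alpha$ in this order. Procesi's monotonicity conjecture in degree $d\ge 1$ says: if $\alpha,\beta\vdash d$ and $\alpha$ comes strictly before $\beta$, then $M_\alpha(\tfrac1d)>M_\beta(\tfrac1d)$. Then the following hold. (0) For all $d$, $r$ and $\alpha\vdash d$, the number of $r$-step monotone walks from $\rho$ to $\sigma$ equals $m^r(\alpha)$ for all $\rho,\sigma\in S(d)$ with $\rho^{-1}\sigma$ of cycle type $\alpha$ (so $m^r(\alpha)$ is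 well defined), and for $d\ge1$ the series $M_\alpha(\tfrac1d)$ converges. (1) Procesi's monotonicity conjecture is false: it does not hold in all degrees $d\ge 1$. In degree $13$, the partition $(1^5,2^4)$ is the successor of $(1^6,7)$, and $$M_{(1^6,7)}\left(\tfrac1{13}\right)=\frac{13^{13}}{(13!)^2}\cdot\frac{30132115571}{1149266300}\;<\;\frac{13^{13}}{(13!)^2}\cdot\frac{426729597219}{16089728200}=M_{(1^5,2^4)}\left(\tfrac1{13}\right).$$ (2) $d=13$ is the first degree in which the conjecture fails: it holds for every $1\le d\le 12$. (3) In degree $13$ this is the only violating consecutive pair: if $\alpha\vdash 13$ has a successor $\alpha^+$ and $M_\alpha(\tfrac1{13})>M_{\alpha^+}(\tfrac1{13})$ does not hold, then $\alpha=(1^6,7)$ and $\alpha^+=(1^5,2^4)$. (4) The conjecture fails in every degree $d$ with $13\le d\le 20$. -/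

import Mathlib

namespace Procesi

/-- The Cayley graph `Γ_d` of the symmetric group of degree `d` generated by all transpositions:
`ρ` and `σ` are adjacent iff `σ = ρ * (i j)` for some transposition `(i j)`. -/
def cayleyGraph (d : ℕ) : SimpleGraph (Equiv.Perm (Fin d)) :=
  SimpleGraph.mulCayley {g : Equiv.Perm (Fin d) | g.IsSwap}

/-- The label of the edge from `ρ` to `σ = ρ * (i j)`: the larger of the two symbols interchanged.
The element `i : Fin d` stands for the symbol `i + 1` of `{1, …, d}`. -/
def edgeLabel {d : ℕ} (ρ σ : Equiv.Perm (Fin d)) : ℕ :=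
  (ρ⁻¹ * σ).support.sup fun i => (i : ℕ) + 1

/-- A walk on `Γ_d` is monotone if the labels of the edges it traverses increase weakly. -/
def IsMonotoneWalk {d : ℕ} {ρ σ : Equiv.Perm (Fin d)} (w : (cayleyGraph d).Walk ρ σ) : Prop :=
  (w.darts.map fun e => edgeLabel e.fst e.snd).Pairwise (· ≤ ·)

/-- The number of `r`-step monotone walks on `Γ_d` from `ρ` to `σ`. -/
noncomputable def numMonotoneWalks {d : ℕ} (r : ℕ) (ρ σ : Equiv.Perm (Fin d)) : ℕ :=
  Nat.card {w : (cayleyGraph d).Walk ρ σ // w.length = r ∧ IsMonotoneWalk w}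

/-- `σ` has cycle type `α`; fixed points count as parts equal to `1`. -/
def HasType {d : ℕ} (σ : Equiv.Perm (Fin d)) (α : Nat.Partition d) : Prop :=
  σ.partition.parts = α.parts

theorem exists_hasType {d : ℕ} (α : Nat.Partition d) :
    ∃ σ : Equiv.Perm (Fin d), HasType σ α := by
  have hsplit : α.parts = α.parts.filter (2 ≤ ·) +
      Multiset.replicate (α.parts.count 1) 1 := by
    rw [← Multiset.filter_eq' α.parts 1]
    conv_lhs => rw [← Multiset.filter_add_not (2 ≤ ·) α.parts]
    congr 1
    apply Multiset.filter_congr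
    intro a ha
    have := α.parts_pos ha
    omega
  have hsum := congrArg Multiset.sum hsplit
  rw [α.parts_sum, Multiset.sum_add, Multiset.sum_replicate, smul_eq_mul, mul_one] at hsum
  obtain ⟨σ, hσ⟩ := (Equiv.Perm.exists_with_cycleType_iff (Fin d)
    (m := α.parts.filter (2 ≤ ·))).mpr
    ⟨by rw [Fintype.card_fin]; omega, fun a ha => (Multiset.mem_filter.mp ha).2⟩
  refine ⟨σ, ?_⟩
  have h2 := Equiv.Perm.sum_cycleType σ
  rw [HasType, Equiv.Perm.parts_partition, ← h2, hσ, Fintype.card_fin]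
  conv_rhs => rw [hsplit]
  congr 2
  omega

/-- A fixed permutation of cycle type `α`. -/
noncomputable def permOfType {d : ℕ} (α : Nat.Partition d) : Equiv.Perm (Fin d) :=
  Classical.choose (exists_hasType α)

/-- `m^r(α)`: the number of `r`-step monotone walks on `Γ_d` beginning at the identity and ending
at a fixed permutation of cycle type `α`. -/
noncomputable def m {d : ℕ} (r : ℕ) (α : Nat.Partition d) : ℕ :=
  numMonotoneWalks r 1 (permOfType α)

/-- The generating function `M_α(x) = ∑_{r ≥ 0} m^r(α) x^r`. -/
noncomputable def M {d : ℕ} (α : Nat.Partition d) (x : ℝ) : ℝ :=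
  ∑' r : ℕ, (m r α : ℝ) * x ^ r

/-- `α` comes strictly before `β` in the lexicographic order on partitions viewed as
nondecreasing sequences of positive integers, where `1` is the first letter of the alphabet. -/
def Precedes {d : ℕ} (α β : Nat.Partition d) : Prop :=
  List.Lex (· < ·) (α.parts.sort (· ≤ ·)) (β.parts.sort (· ≤ ·))

/-- `β` is the successor of `α` in the lexicographic order. -/
def IsSuccessor {d : ℕ} (α β : Nat.Partition d) : Prop :=
  Precedes α β ∧ ∀ γ : Nat.Partition d, ¬(Precedes α γ ∧ Precedes γ β)

/-- The monotonicity conjecture in degree `d`: the numbers `M_α(1/d)` strictly decrease as `α`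
moves down the lexicographic list of the partitions of `d`. -/
def MonotonicityConjecture (d : ℕ) : Prop :=
  ∀ α β : Nat.Partition d, Precedes α β → M β (1 / (d : ℝ)) < M α (1 / (d : ℝ))

/-- The partition `(1^6, 7)` of `13`. -/
def partOneSixSeven : Nat.Partition 13 where
  parts := Multiset.replicate 6 1 + {7}
  parts_pos := by intro i hi; simp at hi; omega
  parts_sum := by simp

/-- The partition `(1^5, 2^4)` of `13`. -/
def partOneFiveTwoFour : Nat.Partition 13 where
  parts := Multiset.replicate 5 1 + Multiset.replicate 4 2
  parts_pos := by intro i hi; simp at hi; omega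
  parts_sum := by simp

end Procesi

/-!
Let `J_k = ∑_{i < k} (i k)` be the Jucys–Murphy elements.  Reading the labels of a monotone walk
shows that the number of `r`-step monotone walks from `ρ` to `σ` is the coefficient at `ρ⁻¹ σ` of
the complete homogeneous symmetric polynomial `h_r(J_0, …, J_{d-1})` (`numMonotoneWalks_eq_coeff`).
Symmetric polynomials in the Jucys–Murphy elements are central (`commute_toPermNat_hsym`), so the
number depends on the cycle type only.  As `J_k` is a sum of `k < d` permutations, the series
`∑_r h_r d⁻ʳ = ∏_k (1 - J_k / d)⁻¹` converges coefficientwise.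

Write `W` for this product in degree `d`, with `1 / N`, `N ≥ d`, in place of `1 / d`.  Comparing
coefficients in `N W_d = N W_{d-1} + W_d J_{d-1}` and working out the cycle types of the products
`σ * (i d-1)` (`exists_perm_cut_join`) gives a linear system: for a partition `(k, β)` of `d` with
`k ≥ 2`,
`N W(k, β) = ∑_{0 < a < k} W(a, k - a, β) + ∑_{j ∈ β} j W(k + j, β - j)`.
The coefficients on the right are nonnegative with sum `d - 1 < N`, hence the system has at most
one solution with a given value at `(1^d)`, and a function that satisfies it up to an error `ε` is
uniformly close to the solution (`abs_walkGF_sub_le`).  The equation at the identity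
(`walkGF_succ_one`) relates the values at `(1^d)` and `(1^(d-1))` for the same `N`, and so fixes the
scale.

It remains to exhibit solutions: for `N = d`, exact ones in integers when `d ≤ 13` and approximate
ones when `14 ≤ d ≤ 20`; for `N = 13`, exact ones in all degrees up to `13`.  The tables are checked
against the linear system by evaluation in the kernel, and the comparisons between the numbers
`M_α(1/d)` become comparisons between their entries.  In all degrees from `13` to `20` the pair
`(1^(d-7), 7)`, `(1^(d-8), 2^4)` violates the conjecture.
-/

namespace Procesi

open Equiv MonoidAlgebra

/-! ### Jucys–Murphy elements and their complete homogeneous polynomials -/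

/-- The Jucys–Murphy element `J_k = ∑_{i < k} (i k)` in the group algebra of the permutations
of `ℕ`.  The symbols are `0, 1, 2, …`, so that the terms of `J_k` carry the edge label `k + 1`. -/
noncomputable def jucysMurphy (k : ℕ) : MonoidAlgebra ℝ (Perm ℕ) :=
  ∑ i ∈ Finset.range k, of ℝ (Perm ℕ) (swap i k)

/-- The complete homogeneous symmetric polynomial of degree `r` in `J_0, …, J_{k-1}`, defined by
splitting off the last factor of a monomial whose indices increase weakly. -/
noncomputable def hsym : ℕ → ℕ → MonoidAlgebra ℝ (Perm ℕ)
  | _, 0 => 1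
  | 0, _ + 1 => 0
  | k + 1, r + 1 => hsym k (r + 1) + hsym (k + 1) r * jucysMurphy k

theorem hsym_zero_right (k : ℕ) : hsym k 0 = 1 := by cases k <;> simp [hsym]

theorem hsym_zero_succ (r : ℕ) : hsym 0 (r + 1) = 0 := by simp [hsym]

theorem hsym_succ_succ (k r : ℕ) :
    hsym (k + 1) (r + 1) = hsym k (r + 1) + hsym (k + 1) r * jucysMurphy k := by
  rw [hsym]

theorem commute_jucysMurphy {g : Perm ℕ} {k : ℕ} (hk : g k = k) (hg : ∀ i < k, g i < k) :
    Commute (of ℝ (Perm ℕ) g) (jucysMurphy k) := by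
  have hmap : Set.MapsTo g (Finset.range k) (Finset.range k) := fun i hi => by
    simpa using hg i (by simpa using hi)
  rw [commute_iff_eq, jucysMurphy, Finset.mul_sum, Finset.sum_mul]
  refine Finset.sum_nbij g (fun i hi => hmap hi) g.injective.injOn
    (Finset.surjOn_of_injOn_of_card_le g hmap g.injective.injOn le_rfl) fun i _ => ?_
  rw [← map_mul, ← map_mul, mul_swap_eq_swap_mul, hk]

theorem commute_swap_jucysMurphy_of_lt {i j k : ℕ} (hi : i < k) (hj : j < k) :
    Commute (of ℝ (Perm ℕ) (swap i j)) (jucysMurphy k) := by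
  refine commute_jucysMurphy (swap_apply_of_ne_of_ne hi.ne' hj.ne') fun a ha => ?_
  rw [swap_apply_def]
  split_ifs <;> assumption

theorem commute_swap_jucysMurphy_of_gt {i j k : ℕ} (hi : k < i) (hj : k < j) :
    Commute (of ℝ (Perm ℕ) (swap i j)) (jucysMurphy k) := by
  refine commute_jucysMurphy (swap_apply_of_ne_of_ne hi.ne hj.ne) fun a ha => ?_
  rwa [swap_apply_of_ne_of_ne (ha.trans hi).ne (ha.trans hj).ne]

theorem commute_jucysMurphy_jucysMurphy_succ (k : ℕ) :
    Commute (jucysMurphy k) (jucysMurphy (k + 1)) := by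
  rw [jucysMurphy]
  refine Commute.sum_left _ _ _ fun i hi => ?_
  have := Finset.mem_range.mp hi
  exact commute_swap_jucysMurphy_of_lt (by omega) (by omega)

/-- The degenerate Hecke relation `s J_k = J_{k+1} s - 1` for `s = (k k+1)`. -/
theorem swap_mul_jucysMurphy (k : ℕ) :
    of ℝ (Perm ℕ) (swap k (k + 1)) * jucysMurphy k =
      jucysMurphy (k + 1) * of ℝ (Perm ℕ) (swap k (k + 1)) - 1 := by
  have h : ∀ i ∈ Finset.range k, of ℝ (Perm ℕ) (swap k (k + 1)) * of ℝ (Perm ℕ) (swap i k) =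
      of ℝ (Perm ℕ) (swap i (k + 1)) * of ℝ (Perm ℕ) (swap k (k + 1)) := fun i hi => by
    have := Finset.mem_range.mp hi
    rw [← map_mul, ← map_mul, mul_swap_eq_swap_mul, swap_apply_left,
      swap_apply_of_ne_of_ne (by omega) (by omega)]
  rw [jucysMurphy, jucysMurphy, Finset.mul_sum, Finset.sum_congr rfl h, ← Finset.sum_mul,
    Finset.sum_range_succ, add_mul, ← map_mul (of ℝ (Perm ℕ)) (swap k (k + 1)), swap_mul_self,
    map_one, add_sub_cancel_right]

theorem jucysMurphy_mul_swap (k : ℕ) :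
    jucysMurphy k * of ℝ (Perm ℕ) (swap k (k + 1)) =
      of ℝ (Perm ℕ) (swap k (k + 1)) * jucysMurphy (k + 1) - 1 := by
  have hs : of ℝ (Perm ℕ) (swap k (k + 1)) * of ℝ (Perm ℕ) (swap k (k + 1)) = 1 := by
    rw [← map_mul, swap_mul_self, map_one]
  have h := swap_mul_jucysMurphy k
  generalize of ℝ (Perm ℕ) (swap k (k + 1)) = s at *
  calc jucysMurphy k * s = s * (s * jucysMurphy k) * s := by rw [← mul_assoc, hs, one_mul]
    _ = s * jucysMurphy (k + 1) * (s * s) - s * s := by rw [h]; noncomm_ring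
    _ = _ := by rw [hs, mul_one]

theorem commute_swap_jucysMurphy_add (k : ℕ) :
    Commute (of ℝ (Perm ℕ) (swap k (k + 1))) (jucysMurphy k + jucysMurphy (k + 1)) := by
  rw [commute_iff_eq, mul_add, add_mul, swap_mul_jucysMurphy, jucysMurphy_mul_swap]
  abel

theorem commute_swap_jucysMurphy_mul (k : ℕ) :
    Commute (of ℝ (Perm ℕ) (swap k (k + 1))) (jucysMurphy (k + 1) * jucysMurphy k) := by
  have h1 := swap_mul_jucysMurphy k
  have h2 := jucysMurphy_mul_swap k
  have h3 := (commute_jucysMurphy_jucysMurphy_succ k).eq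
  generalize of ℝ (Perm ℕ) (swap k (k + 1)) = s at *
  rw [commute_iff_eq, ← h3, ← mul_assoc, h1, sub_mul, mul_assoc, one_mul, h3, mul_assoc, h2,
    mul_sub, mul_one, ← mul_assoc]

theorem commute_swap_hsym_of_le {i j : ℕ} (k r : ℕ) (hi : k ≤ i) (hj : k ≤ j) :
    Commute (of ℝ (Perm ℕ) (swap i j)) (hsym k r) := by
  induction k generalizing r with
  | zero => cases r with
    | zero => rw [hsym_zero_right]; exact Commute.one_right _
    | succ r => rw [hsym_zero_succ]; exact Commute.zero_right _
  | succ k ihk => induction r with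
    | zero => rw [hsym_zero_right]; exact Commute.one_right _
    | succ r ihr =>
      rw [hsym_succ_succ]
      exact (ihk _ (by omega) (by omega)).add_right
        (ihr.mul_right (commute_swap_jucysMurphy_of_gt hi hj))

/-- The recursion for complete homogeneous polynomials that splits off the last two variables at
once; it involves these only through their elementary symmetric polynomials. -/
theorem hsym_add_two (k r : ℕ) :
    hsym (k + 2) (r + 2) = hsym k (r + 2) +
      hsym (k + 2) (r + 1) * (jucysMurphy k + jucysMurphy (k + 1)) -
      hsym (k + 2) r * (jucysMurphy (k + 1) * jucysMurphy k) := by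
  have h := hsym_succ_succ (k + 1) r
  rw [hsym_succ_succ (k + 1) (r + 1), hsym_succ_succ k (r + 1),
    show hsym (k + 1) (r + 1) = hsym (k + 2) (r + 1) - hsym (k + 2) r * jucysMurphy (k + 1) by
      rw [h]; abel]
  noncomm_ring

theorem commute_swap_hsym {i k : ℕ} (r : ℕ) (hi : i + 1 < k) :
    Commute (of ℝ (Perm ℕ) (swap i (i + 1))) (hsym k r) := by
  induction k generalizing r with
  | zero => omega
  | succ k ihk =>
    rcases Nat.lt_or_ge (i + 1) k with hk | hk
    · induction r with
      | zero => rw [hsym_zero_right]; exact Commute.one_right _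
      | succ r ihr =>
        rw [hsym_succ_succ]
        exact (ihk _ hk).add_right
          (ihr.mul_right (commute_swap_jucysMurphy_of_lt (by omega) (by omega)))
    · obtain rfl : k = i + 1 := by omega
      induction r using Nat.twoStepInduction with
      | zero => rw [hsym_zero_right]; exact Commute.one_right _
      | one =>
        have h := commute_swap_jucysMurphy_add i
        rw [hsym_succ_succ, hsym_succ_succ, hsym_zero_right, hsym_zero_right, one_mul, one_mul,
          add_assoc]
        exact (commute_swap_hsym_of_le i 1 le_rfl (by omega)).add_right h
      | more r h0 h1 =>
        rw [hsym_add_two]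
        exact ((commute_swap_hsym_of_le i _ le_rfl (by omega)).add_right
          (h1.mul_right (commute_swap_jucysMurphy_add i))).sub_right
          (h0.mul_right (commute_swap_jucysMurphy_mul i))

/-! ### Coefficients as class functions on the symmetric groups -/

/-- The embedding of the symmetric group of degree `d` into the permutations of `ℕ`. -/
noncomputable def toPermNat (d : ℕ) : Perm (Fin d) →* Perm ℕ :=
  Perm.viaEmbeddingHom Fin.valEmbedding

theorem toPermNat_apply {d : ℕ} (σ : Perm (Fin d)) (x : Fin d) :
    toPermNat d σ x = (σ x : ℕ) :=
  Perm.viaEmbedding_apply σ Fin.valEmbedding x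

theorem toPermNat_apply_of_le {d : ℕ} (σ : Perm (Fin d)) {x : ℕ} (hx : d ≤ x) :
    toPermNat d σ x = x :=
  Perm.viaEmbedding_apply_of_notMem σ Fin.valEmbedding x fun ⟨y, hy⟩ => by
    have : (y : ℕ) = x := hy
    omega

theorem toPermNat_swap {d : ℕ} (i j : Fin d) : toPermNat d (swap i j) = swap (i : ℕ) j := by
  ext x
  rcases Nat.lt_or_ge x d with hx | hx
  · rw [show x = ((⟨x, hx⟩ : Fin d) : ℕ) from rfl, toPermNat_apply, swap_apply_def, swap_apply_def]
    simp only [Fin.ext_iff]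
    split_ifs <;> rfl
  · rw [toPermNat_apply_of_le _ hx, swap_apply_of_ne_of_ne] <;> omega

theorem toPermNat_eq_one_iff {d : ℕ} (σ : Perm (Fin d)) : toPermNat d σ = 1 ↔ σ = 1 :=
  map_eq_one_iff _ (Perm.viaEmbeddingHom_injective _)

theorem commute_toPermNat_hsym {d : ℕ} (r : ℕ) (σ : Perm (Fin d)) :
    Commute (of ℝ (Perm ℕ) (toPermNat d σ)) (hsym d r) := by
  rcases d with _ | n
  · rw [Subsingleton.elim σ 1, map_one, map_one]
    exact Commute.one_left _
  have hσ : σ ∈ Submonoid.closure (Set.range fun i : Fin n => swap i.castSucc i.succ) := by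
    rw [Perm.mclosure_swap_castSucc_succ]; trivial
  induction hσ using Submonoid.closure_induction with
  | mem x hx =>
    obtain ⟨i, rfl⟩ := hx
    rw [toPermNat_swap]
    exact commute_swap_hsym r (by simp)
  | one => rw [map_one, map_one]; exact Commute.one_left _
  | mul x y _ _ hx hy => rw [map_mul, map_mul]; exact hx.mul_left hy

theorem coeff_hsym_eq_of_isConj {d : ℕ} (r : ℕ) {σ τ : Perm (Fin d)} (h : IsConj σ τ) :
    (hsym d r).coeff (toPermNat d σ) = (hsym d r).coeff (toPermNat d τ) := by
  obtain ⟨g, rfl⟩ := isConj_iff.mp h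
  have hc := congrArg (fun x => x.coeff (toPermNat d (g * σ))) (commute_toPermNat_hsym r g).eq
  simpa [coeff_mul_single_apply, coeff_single_mul_apply, mul_assoc] using hc

theorem coeff_hsym_zero (k : ℕ) (g : Perm ℕ) [Decidable (g = 1)] :
    (hsym k 0).coeff g = if g = 1 then 1 else 0 := by
  classical
  rw [hsym_zero_right, MonoidAlgebra.one_def, coeff_single, Finsupp.single_apply]
  simp only [eq_comm]

theorem coeff_hsym_succ_succ (k r : ℕ) (g : Perm ℕ) :
    (hsym (k + 1) (r + 1)).coeff g = (hsym k (r + 1)).coeff g +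
      ∑ i ∈ Finset.range k, (hsym (k + 1) r).coeff (g * swap i k) := by
  rw [hsym_succ_succ, jucysMurphy, Finset.mul_sum, coeff_add, coeff_sum, Finsupp.add_apply,
    Finsupp.finsetSum_apply]
  simp [coeff_mul_single_apply]

theorem coeff_hsym_nonneg (k r : ℕ) (g : Perm ℕ) : 0 ≤ (hsym k r).coeff g := by
  classical
  induction k generalizing r g with
  | zero => cases r with
    | zero => rw [coeff_hsym_zero]; split_ifs <;> norm_num
    | succ r => rw [hsym_zero_succ]; simp
  | succ k ihk => induction r generalizing g with
    | zero => rw [coeff_hsym_zero]; split_ifs <;> norm_num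
    | succ r ihr =>
      rw [coeff_hsym_succ_succ]
      exact add_nonneg (ihk _ _) (Finset.sum_nonneg fun i _ => ihr _)

theorem coeff_hsym_eq_zero {k x : ℕ} (r : ℕ) {g : Perm ℕ} (hx : k ≤ x) (hg : g x ≠ x) :
    (hsym k r).coeff g = 0 := by
  classical
  have h1 : ∀ g : Perm ℕ, g x ≠ x → g ≠ 1 := by rintro _ h rfl; exact h rfl
  induction k generalizing r g with
  | zero => cases r with
    | zero => rw [coeff_hsym_zero, if_neg (h1 g hg)]
    | succ r => rw [hsym_zero_succ]; simp
  | succ k ihk => induction r generalizing g with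
    | zero => rw [coeff_hsym_zero, if_neg (h1 g hg)]
    | succ r ihr =>
      rw [coeff_hsym_succ_succ, ihk _ (by omega) hg, zero_add]
      refine Finset.sum_eq_zero fun i hi => ihr ?_
      have := Finset.mem_range.mp hi
      rwa [Perm.mul_apply, swap_apply_of_ne_of_ne (by omega) (by omega)]

/-! ### Monotone walks as coefficients -/

/-- The labels along a walk, in the order of traversal. -/
def walkLabels {d : ℕ} {ρ σ : Perm (Fin d)} (w : (cayleyGraph d).Walk ρ σ) : List ℕ :=
  w.darts.map fun e => edgeLabel e.fst e.snd

theorem cayleyGraph_adj {d : ℕ} (ρ σ : Perm (Fin d)) :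
    (cayleyGraph d).Adj ρ σ ↔ (ρ⁻¹ * σ).IsSwap := by
  rw [cayleyGraph, SimpleGraph.mulCayley_adj, Set.mem_ofPred_eq, Set.mem_ofPred_eq]
  have hinv : (σ⁻¹ * ρ).IsSwap → (ρ⁻¹ * σ).IsSwap := by
    rintro ⟨x, y, hxy, h⟩
    exact ⟨x, y, hxy, by rw [← swap_inv, ← h]; group⟩
  refine ⟨fun h => h.2.elim id hinv, fun h => ⟨?_, Or.inl h⟩⟩
  rintro rfl
  obtain ⟨x, y, hxy, h⟩ := h
  rw [inv_mul_cancel] at h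
  exact hxy (swap_eq_one_iff.mp h.symm)

theorem edgeLabel_comm {d : ℕ} (ρ σ : Perm (Fin d)) : edgeLabel ρ σ = edgeLabel σ ρ := by
  rw [edgeLabel, edgeLabel, ← Perm.support_inv, mul_inv_rev, inv_inv]

theorem edgeLabel_mul_swap {d : ℕ} (ρ : Perm (Fin d)) {i j : Fin d} (h : i < j) :
    edgeLabel ρ (ρ * swap i j) = j + 1 := by
  rw [edgeLabel, inv_mul_cancel_left, Perm.support_swap h.ne]
  simp only [Finset.sup_insert, Finset.sup_singleton]
  exact sup_eq_right.mpr (by simpa using h.le)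

theorem exists_eq_mul_swap {d : ℕ} {ρ σ : Perm (Fin d)} (h : (cayleyGraph d).Adj ρ σ) :
    ∃ i j : Fin d, i < j ∧ σ = ρ * swap i j := by
  obtain ⟨x, y, hxy, h⟩ := (cayleyGraph_adj ρ σ).mp h
  have hσ : σ = ρ * swap x y := by rw [← h, mul_inv_cancel_left]
  rcases hxy.lt_or_gt with hlt | hlt
  · exact ⟨x, y, hlt, hσ⟩
  · exact ⟨y, x, hlt, by rw [swap_comm, hσ]⟩

theorem adj_mul_swap {d : ℕ} (ρ : Perm (Fin d)) {i j : Fin d} (h : i < j) :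
    (cayleyGraph d).Adj ρ (ρ * swap i j) :=
  (cayleyGraph_adj _ _).mpr ⟨i, j, h.ne, inv_mul_cancel_left _ _⟩

/-- The walks of length `r` whose labels decrease weakly and do not exceed `k`.  These are the
reversals of the monotone walks; in this direction the edge with the largest label comes first. -/
abbrev AntitoneWalk {d : ℕ} (k r : ℕ) (σ ρ : Perm (Fin d)) : Type :=
  {w : (cayleyGraph d).Walk σ ρ //
    w.length = r ∧ (walkLabels w).Pairwise (· ≥ ·) ∧ ∀ l ∈ walkLabels w, l ≤ k}

theorem walkLabels_cons {d : ℕ} {σ τ ρ : Perm (Fin d)} (h : (cayleyGraph d).Adj σ τ)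
    (w : (cayleyGraph d).Walk τ ρ) :
    walkLabels (.cons h w) = edgeLabel σ τ :: walkLabels w := rfl

/-- An antitone walk with labels at most `k + 1` either has labels at most `k` or begins with an
edge labelled `k + 1`. -/
noncomputable def antitoneWalkEquiv {d : ℕ} (k r : ℕ) (hk : k < d) (σ ρ : Perm (Fin d)) :
    AntitoneWalk k (r + 1) σ ρ ⊕
      (Σ i : Fin k, AntitoneWalk (k + 1) r (σ * swap (i.castLE hk.le) ⟨k, hk⟩) ρ) ≃
    AntitoneWalk (k + 1) (r + 1) σ ρ :=
  have hlt (i : Fin k) : i.castLE hk.le < (⟨k, hk⟩ : Fin d) := by simp [Fin.lt_def]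
  Equiv.ofBijective (Sum.elim
    (fun w => ⟨w.1, w.2.1, w.2.2.1, fun l hl => (w.2.2.2 l hl).trans k.le_succ⟩)
    (fun x => ⟨.cons (adj_mul_swap σ (hlt x.1)) x.2.1, by
      obtain ⟨i, w, hw1, hw2, hw3⟩ := x
      rw [walkLabels_cons, edgeLabel_mul_swap σ (hlt i)]
      refine ⟨by simpa using hw1, List.pairwise_cons.mpr ⟨hw3, hw2⟩, ?_⟩
      simpa using hw3⟩)) <| by
    constructor
    · rintro (⟨w, hw⟩ | ⟨i, w, hw⟩) (⟨w', hw'⟩ | ⟨i', w', hw'⟩) heq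
      · simpa using heq
      · have hval : w = .cons (adj_mul_swap σ (hlt i')) w' := congrArg Subtype.val heq
        have := hw.2.2 (k + 1) (by
          rw [hval, walkLabels_cons, edgeLabel_mul_swap σ (hlt i')]; exact List.mem_cons_self)
        omega
      · have hval : .cons (adj_mul_swap σ (hlt i)) w = w' := congrArg Subtype.val heq
        have := hw'.2.2 (k + 1) (by
          rw [← hval, walkLabels_cons, edgeLabel_mul_swap σ (hlt i)]; exact List.mem_cons_self)
        omega
      · have hval : SimpleGraph.Walk.cons (adj_mul_swap σ (hlt i)) w =
            .cons (adj_mul_swap σ (hlt i')) w' := congrArg Subtype.val heq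
        injection hval with _ h2 _ h3
        have h4 := congrArg (fun g : Perm (Fin d) => g ⟨k, hk⟩) (mul_left_cancel h2)
        simp only [swap_apply_right] at h4
        obtain rfl : i = i' := by simpa [Fin.ext_iff] using h4
        obtain rfl := eq_of_heq h3
        rfl
    · rintro ⟨w, hw1, hw2, hw3⟩
      cases w with
      | nil => simp at hw1
      | @cons _ τ _ h w =>
        obtain ⟨i, j, hij, rfl⟩ := exists_eq_mul_swap h
        rw [walkLabels_cons, edgeLabel_mul_swap σ hij] at hw2 hw3
        obtain ⟨hw4, hw5⟩ := List.pairwise_cons.mp hw2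
        have hj : (j : ℕ) + 1 ≤ k + 1 := hw3 _ List.mem_cons_self
        rcases hj.lt_or_eq with hj | hj
        · refine ⟨.inl ⟨.cons h w, hw1, ?_⟩, rfl⟩
          rw [walkLabels_cons, edgeLabel_mul_swap σ hij]
          refine ⟨hw2, fun l hl => ?_⟩
          rcases List.mem_cons.mp hl with rfl | hl
          · omega
          · have := hw4 l hl
            omega
        · obtain rfl : j = ⟨k, hk⟩ := Fin.ext (by simpa using hj)
          exact ⟨.inr ⟨⟨i, hij⟩, w, by simpa using hw1, hw5, fun l hl => hw4 l hl⟩, rfl⟩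

theorem card_antitoneWalk {d : ℕ} (k r : ℕ) (hk : k ≤ d) (σ ρ : Perm (Fin d)) :
    Finite (AntitoneWalk k r σ ρ) ∧
      (Nat.card (AntitoneWalk k r σ ρ) : ℝ) = (hsym k r).coeff (toPermNat d (ρ⁻¹ * σ)) := by
  have hzero (k : ℕ) (σ : Perm (Fin d)) : Finite (AntitoneWalk k 0 σ ρ) ∧
      (Nat.card (AntitoneWalk k 0 σ ρ) : ℝ) = (hsym k 0).coeff (toPermNat d (ρ⁻¹ * σ)) := by
    classical
    rw [coeff_hsym_zero]
    simp only [toPermNat_eq_one_iff, inv_mul_eq_one]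
    by_cases h : ρ = σ
    · subst h
      have : Unique (AntitoneWalk k 0 ρ ρ) :=
        { default := ⟨.nil, rfl, by simp [walkLabels], by simp [walkLabels]⟩
          uniq := fun w => Subtype.ext (SimpleGraph.Walk.eq_nil_iff_nil.mpr
            (SimpleGraph.Walk.length_eq_zero_iff.mp w.2.1)) }
      exact ⟨inferInstance, by simp⟩
    · have : IsEmpty (AntitoneWalk k 0 σ ρ) :=
        ⟨fun w => h (SimpleGraph.Walk.eq_of_length_eq_zero w.2.1).symm⟩
      exact ⟨inferInstance, by simp [h]⟩
  induction k generalizing r σ with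
  | zero =>
    cases r with
    | zero => exact hzero 0 σ
    | succ r =>
      have : IsEmpty (AntitoneWalk 0 (r + 1) σ ρ) := ⟨fun ⟨w, hw1, _, hw3⟩ => by
        cases w with
        | nil => simp at hw1
        | @cons _ τ _ h w =>
          obtain ⟨i, j, hij, rfl⟩ := exists_eq_mul_swap h
          rw [walkLabels_cons, edgeLabel_mul_swap σ hij] at hw3
          have := hw3 _ List.mem_cons_self
          omega⟩
      exact ⟨inferInstance, by simp [hsym_zero_succ]⟩
  | succ k ihk =>
    induction r generalizing σ with
    | zero => exact hzero (k + 1) σ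
    | succ r ihr =>
      have e := antitoneWalkEquiv k r hk σ ρ
      have := (ihk (r + 1) (by omega) σ).1
      have (i : Fin k) := (ihr (σ * swap (i.castLE (by omega)) ⟨k, hk⟩)).1
      refine ⟨Finite.of_equiv _ e, ?_⟩
      rw [← Nat.card_congr e, Nat.card_sum, Nat.card_sigma, Nat.cast_add, Nat.cast_sum,
        (ihk (r + 1) (by omega) σ).2, coeff_hsym_succ_succ, ← Fin.sum_univ_eq_sum_range]
      congr 1
      refine Finset.sum_congr rfl fun i _ => ?_
      rw [(ihr _).2, ← mul_assoc, map_mul _ (ρ⁻¹ * σ), toPermNat_swap]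
      rfl

theorem walkLabels_reverse {d : ℕ} {ρ σ : Perm (Fin d)} (w : (cayleyGraph d).Walk ρ σ) :
    walkLabels w.reverse = (walkLabels w).reverse := by
  rw [walkLabels, walkLabels, SimpleGraph.Walk.darts_reverse, List.map_reverse, List.map_map]
  congr 2
  funext e
  exact edgeLabel_comm _ _

theorem le_of_mem_walkLabels {d : ℕ} {ρ σ : Perm (Fin d)} (w : (cayleyGraph d).Walk ρ σ) :
    ∀ l ∈ walkLabels w, l ≤ d := by
  intro l hl
  obtain ⟨e, _, rfl⟩ := List.mem_map.mp hl
  exact Finset.sup_le fun i _ => i.2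

theorem numMonotoneWalks_eq_coeff {d : ℕ} (r : ℕ) (ρ σ : Perm (Fin d)) :
    (numMonotoneWalks r ρ σ : ℝ) = (hsym d r).coeff (toPermNat d (ρ⁻¹ * σ)) := by
  rw [← (card_antitoneWalk d r le_rfl σ ρ).2, numMonotoneWalks]
  congr 1
  refine Nat.card_congr
    { toFun := fun w => ⟨w.1.reverse, by simpa using w.2.1, ?_, le_of_mem_walkLabels _⟩
      invFun := fun w => ⟨w.1.reverse, by simpa using w.2.1, ?_⟩
      left_inv := fun w => Subtype.ext w.1.reverse_reverse
      right_inv := fun w => Subtype.ext w.1.reverse_reverse }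
  · rw [walkLabels_reverse, List.pairwise_reverse]
    exact w.2.2
  · change (walkLabels w.1.reverse).Pairwise (· ≤ ·)
    rw [walkLabels_reverse, List.pairwise_reverse]
    exact w.2.2.1

theorem isConj_of_parts_eq {d : ℕ} {σ τ : Perm (Fin d)}
    (h : σ.partition.parts = τ.partition.parts) : IsConj σ τ :=
  Perm.partition_eq_of_isConj.mpr (Nat.Partition.ext h)

theorem m_eq_coeff {d : ℕ} (r : ℕ) {α : Nat.Partition d} {σ : Perm (Fin d)} (h : HasType σ α) :
    (m r α : ℝ) = (hsym d r).coeff (toPermNat d σ) := by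
  rw [m, numMonotoneWalks_eq_coeff, inv_one, one_mul]
  exact coeff_hsym_eq_of_isConj r
    (isConj_of_parts_eq ((Classical.choose_spec (exists_hasType α)).trans h.symm))

theorem numMonotoneWalks_eq_m {d : ℕ} (r : ℕ) {α : Nat.Partition d} {ρ σ : Perm (Fin d)}
    (h : HasType (ρ⁻¹ * σ) α) : numMonotoneWalks r ρ σ = m r α := by
  exact_mod_cast (numMonotoneWalks_eq_coeff r ρ σ).trans (m_eq_coeff r h).symm

/-! ### Generating functions at `1 / N` -/

/-- The coefficient at `g` of `∏_{j < k} (1 - J_j / N)⁻¹ = ∑_r h_r(J_0, …, J_{k-1}) N⁻ʳ`. -/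
noncomputable def walkGF (N k : ℕ) (g : Perm ℕ) : ℝ :=
  ∑' r : ℕ, (hsym k r).coeff g * (1 / (N : ℝ)) ^ r

/-- The partial sums of `walkGF N k` are bounded by `∏_{j < k} (1 - j / N)⁻¹`, because `J_j` is a
sum of `j < N` permutations. -/
theorem exists_sum_range_coeff_le {N k : ℕ} (hk : k ≤ N) : ∃ C : ℝ, ∀ (R : ℕ) (g : Perm ℕ),
    ∑ r ∈ Finset.range R, (hsym k r).coeff g * (1 / (N : ℝ)) ^ r ≤ C := by
  classical
  induction k with
  | zero =>
    refine ⟨1, fun R g => ?_⟩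
    cases R with
    | zero => simp
    | succ R =>
      rw [Finset.sum_range_succ', coeff_hsym_zero]
      simp only [hsym_zero_succ, coeff_zero, Finsupp.zero_apply, zero_mul, Finset.sum_const_zero]
      split_ifs <;> norm_num
  | succ k ih =>
    obtain ⟨C, hC⟩ := ih (by omega)
    have hN : (0 : ℝ) < N := by exact_mod_cast (show 0 < N by omega)
    have hkN : (k : ℝ) < N := by exact_mod_cast hk
    have hpos : 0 < 1 - k / (N : ℝ) := by rw [sub_pos, div_lt_one hN]; exact hkN
    have hC0 : 0 ≤ C := by simpa using hC 0 1
    refine ⟨C / (1 - k / (N : ℝ)), fun R => ?_⟩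
    induction R with
    | zero => intro g; simpa using div_nonneg hC0 hpos.le
    | succ R ihR =>
      intro g
      calc ∑ r ∈ Finset.range (R + 1), (hsym (k + 1) r).coeff g * (1 / (N : ℝ)) ^ r
          = ∑ r ∈ Finset.range (R + 1), (hsym k r).coeff g * (1 / (N : ℝ)) ^ r +
            1 / (N : ℝ) * ∑ i ∈ Finset.range k, ∑ r ∈ Finset.range R,
              (hsym (k + 1) r).coeff (g * swap i k) * (1 / (N : ℝ)) ^ r := by
            rw [Finset.sum_range_succ', Finset.sum_range_succ', hsym_zero_right, hsym_zero_right,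
              Finset.sum_comm, Finset.mul_sum, add_right_comm, ← Finset.sum_add_distrib]
            congr 1
            refine Finset.sum_congr rfl fun r _ => ?_
            rw [coeff_hsym_succ_succ, add_mul, Finset.sum_mul, Finset.mul_sum]
            congr 1
            exact Finset.sum_congr rfl fun i _ => by ring
        _ ≤ C + 1 / (N : ℝ) * ∑ i ∈ Finset.range k, C / (1 - k / (N : ℝ)) := by
            gcongr
            · exact hC _ _
            · exact ihR _
        _ = C / (1 - k / (N : ℝ)) := by
            rw [Finset.sum_const, Finset.card_range, nsmul_eq_mul]
            have hne : (N : ℝ) - k ≠ 0 := sub_ne_zero.mpr hkN.ne'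
            field_simp
            ring

theorem summable_coeff_hsym {N k : ℕ} (hk : k ≤ N) (g : Perm ℕ) :
    Summable fun r : ℕ => (hsym k r).coeff g * (1 / (N : ℝ)) ^ r := by
  obtain ⟨C, hC⟩ := exists_sum_range_coeff_le hk
  exact summable_of_sum_range_le
    (fun r => mul_nonneg (coeff_hsym_nonneg _ _ _) (by positivity)) fun R => hC R g

theorem walkGF_one_pos {N k : ℕ} (hk : k ≤ N) : 0 < walkGF N k 1 := by
  classical
  have h := (summable_coeff_hsym hk 1).le_tsum 0
    fun r _ => mul_nonneg (coeff_hsym_nonneg k r 1) (by positivity)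
  rw [coeff_hsym_zero, if_pos rfl, pow_zero, mul_one] at h
  exact zero_lt_one.trans_le h

theorem walkGF_zero_one (N : ℕ) : walkGF N 0 1 = 1 := by
  classical
  rw [walkGF, tsum_eq_single 0, coeff_hsym_zero]
  · simp
  · intro r hr
    obtain ⟨r, rfl⟩ := Nat.exists_eq_succ_of_ne_zero hr
    simp [hsym_zero_succ]

theorem walkGF_eq_zero {N k x : ℕ} {g : Perm ℕ} (hx : k ≤ x) (hg : g x ≠ x) :
    walkGF N k g = 0 := by
  simp [walkGF, coeff_hsym_eq_zero _ hx hg]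

/-- The linear system for the coefficients of `W_{k+1} = ∏_{j ≤ k} (1 - J_j / N)⁻¹`, in the form
`N W_{k+1} = N W_k + W_{k+1} J_k`. -/
theorem walkGF_succ {N k : ℕ} (hk : k < N) (g : Perm ℕ) :
    N * walkGF N (k + 1) g =
      N * walkGF N k g + ∑ i ∈ Finset.range k, walkGF N (k + 1) (g * swap i k) := by
  have hN : (N : ℝ) ≠ 0 := by exact_mod_cast (show N ≠ 0 by omega)
  have hs1 := summable_coeff_hsym (show k ≤ N by omega) g
  have hs2 (g : Perm ℕ) := summable_coeff_hsym (show k + 1 ≤ N by omega) g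
  have hs3 := (summable_nat_add_iff 1).mpr hs1
  have hs4 : Summable fun r : ℕ => ∑ i ∈ Finset.range k,
      (hsym (k + 1) r).coeff (g * swap i k) * (1 / (N : ℝ)) ^ r :=
    summable_sum fun i _ => hs2 _
  have key : walkGF N (k + 1) g = walkGF N k g +
      1 / N * ∑ i ∈ Finset.range k, walkGF N (k + 1) (g * swap i k) := by
    simp only [walkGF]
    rw [← Summable.tsum_finsetSum fun i _ => hs2 _, ← tsum_mul_left, (hs2 g).tsum_eq_zero_add,
      hs1.tsum_eq_zero_add, hsym_zero_right, hsym_zero_right, add_assoc,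
      ← hs3.tsum_add (hs4.mul_left _)]
    congr 2
    funext r
    rw [coeff_hsym_succ_succ, add_mul, Finset.sum_mul, Finset.mul_sum]
    congr 1
    exact Finset.sum_congr rfl fun i _ => by ring
  rw [key]
  field_simp

theorem walkGF_eq_of_isConj {N d : ℕ} {σ τ : Perm (Fin d)} (h : IsConj σ τ) :
    walkGF N d (toPermNat d σ) = walkGF N d (toPermNat d τ) := by
  simp only [walkGF, coeff_hsym_eq_of_isConj _ h]

theorem summable_m {d : ℕ} (α : Nat.Partition d) :
    Summable fun r : ℕ => (m r α : ℝ) * (1 / (d : ℝ)) ^ r := by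
  obtain ⟨σ, hσ⟩ := exists_hasType α
  simpa only [m_eq_coeff _ hσ] using summable_coeff_hsym le_rfl (toPermNat d σ)

theorem M_eq_walkGF {d : ℕ} {α : Nat.Partition d} {σ : Perm (Fin d)} (h : HasType σ α) :
    M α (1 / (d : ℝ)) = walkGF d d (toPermNat d σ) := by
  simp only [M, walkGF, m_eq_coeff _ h]

/-! ### Cycle types under multiplication by a transposition -/

section Blocks

variable {α : Type*} [DecidableEq α]

/-- The product of the cycles written in the lists of `L`. -/
def cyclePerm (L : List (List α)) : Perm α := (L.map List.formPerm).prod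

theorem cyclePerm_cons (l : List α) (L : List (List α)) :
    cyclePerm (l :: L) = l.formPerm * cyclePerm L := by
  rw [cyclePerm, List.map_cons, List.prod_cons, cyclePerm]

theorem formPerm_append_cons (l : List α) (a : α) (m : List α) :
    (l ++ a :: m).formPerm = (l ++ [a]).formPerm * (a :: m).formPerm := by
  induction l with
  | nil => simp
  | cons x l ih => cases l with
    | nil => simp
    | cons y l =>
      simp only [List.cons_append, List.formPerm_cons_cons, mul_assoc] at ih ⊢
      rw [ih]

/-- Multiplication by a transposition joins two cycles into one; since a transposition is an
involution, the identity also describes how a cycle is cut into two. -/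
theorem swap_mul_formPerm_mul_formPerm {x a : α} {l m : List α} (h : (x :: l ++ a :: m).Nodup) :
    swap a x * ((x :: l).formPerm * (a :: m).formPerm) = (x :: l ++ a :: m).formPerm := by
  have hn : (x :: l ++ [a]).Nodup := by
    refine h.sublist (List.Sublist.append_left ?_ _)
    simp
  rw [formPerm_append_cons (x :: l) a m, ← mul_assoc, ← List.formPerm_cons_cons]
  congr 1
  exact (List.formPerm_eq_of_isRotated hn (List.isRotated_append (l := x :: l) (l' := [a]))).symm

theorem formPerm_disjoint_of_list_disjoint {l m : List α} (h : l.Disjoint m) :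
    Perm.Disjoint l.formPerm m.formPerm := by
  intro x
  by_cases hx : x ∈ l
  · exact Or.inr (List.formPerm_apply_of_notMem (h hx))
  · exact Or.inl (List.formPerm_apply_of_notMem hx)

theorem cyclePerm_apply_of_notMem {L : List (List α)} {x : α} (hx : x ∉ L.flatten) :
    cyclePerm L x = x := by
  induction L with
  | nil => rfl
  | cons l L ih =>
    rw [List.flatten_cons, List.mem_append, not_or] at hx
    rw [cyclePerm_cons, Perm.mul_apply, ih hx.2, List.formPerm_apply_of_notMem hx.1]

theorem cyclePerm_eq_of_perm {L L' : List (List α)} (hL : L.flatten.Nodup) (h : L.Perm L') :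
    cyclePerm L = cyclePerm L' := by
  refine (h.map _).prod_eq' (List.pairwise_map.mpr ((List.nodup_flatten.mp hL).2.imp ?_))
  exact fun h => (formPerm_disjoint_of_list_disjoint h).commute

variable [Fintype α]

theorem cycleType_formPerm_eq_filter {l : List α} (hl : l.Nodup) :
    l.formPerm.cycleType = ({l.length} : Multiset ℕ).filter (2 ≤ ·) := by
  by_cases h : 2 ≤ l.length
  · rw [Multiset.filter_singleton, if_pos h, (List.isCycle_formPerm hl h).cycleType,
      List.support_formPerm_of_nodup l hl (by rintro x rfl; simp at h),
      List.toFinset_card_of_nodup hl]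
  · rw [Multiset.filter_singleton, if_neg h, (List.formPerm_eq_one_iff l hl).mpr (by omega),
      Perm.cycleType_one]
    rfl

theorem cycleType_cyclePerm {L : List (List α)} (hL : L.flatten.Nodup) :
    (cyclePerm L).cycleType = ((L.map List.length : List ℕ) : Multiset ℕ).filter (2 ≤ ·) := by
  induction L with
  | nil => simp [cyclePerm]
  | cons l L ih =>
    rw [List.flatten_cons, List.nodup_append'] at hL
    have hdisj : Perm.Disjoint l.formPerm (cyclePerm L) := fun x => by
      by_cases hx : x ∈ l
      · exact Or.inr (cyclePerm_apply_of_notMem (hL.2.2 hx))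
      · exact Or.inl (List.formPerm_apply_of_notMem hx)
    rw [cyclePerm_cons, hdisj.cycleType_mul, ih hL.2.1, cycleType_formPerm_eq_filter hL.1,
      List.map_cons, ← Multiset.cons_coe, ← Multiset.singleton_add, Multiset.filter_add]

theorem eq_filter_add_replicate {s : Multiset ℕ} (hs : ∀ a ∈ s, 0 < a) :
    s = s.filter (2 ≤ ·) + Multiset.replicate (s.sum - (s.filter (2 ≤ ·)).sum) 1 := by
  have hsplit : s = s.filter (2 ≤ ·) + Multiset.replicate (s.count 1) 1 := by
    rw [← Multiset.filter_eq' s 1]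
    conv_lhs => rw [← Multiset.filter_add_not (2 ≤ ·) s]
    congr 1
    refine Multiset.filter_congr fun a ha => ?_
    have := hs a ha
    omega
  have hsum := congrArg Multiset.sum hsplit
  rw [Multiset.sum_add, Multiset.sum_replicate, smul_eq_mul, mul_one] at hsum
  rw [hsum, Nat.add_sub_cancel_left]
  exact hsplit

theorem parts_partition_cyclePerm {L : List (List α)} (hL : L.flatten.Nodup) (hne : [] ∉ L)
    (hcard : L.flatten.length = Fintype.card α) :
    (cyclePerm L).partition.parts = ((L.map List.length : List ℕ) : Multiset ℕ) := by
  have hsum : ((L.map List.length : List ℕ) : Multiset ℕ).sum = Fintype.card α := by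
    rw [Multiset.sum_coe, ← List.length_flatten, hcard]
  rw [eq_filter_add_replicate (s := (cyclePerm L).partition.parts)
      fun _ => (cyclePerm L).partition.parts_pos, (cyclePerm L).partition.parts_sum,
    Perm.filter_parts_partition_eq_cycleType, cycleType_cyclePerm hL, ← hsum]
  refine (eq_filter_add_replicate fun a ha => ?_).symm
  obtain ⟨l, hl, rfl⟩ := List.mem_map.mp (Multiset.mem_coe.mp ha)
  exact List.length_pos_iff.mpr fun h => hne (h ▸ hl)

end Blocks

theorem exists_flatten_eq {α : Type*} (s : List ℕ) (xs : List α) (h : xs.length = s.sum) :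
    ∃ L : List (List α), L.flatten = xs ∧ L.map List.length = s := by
  induction s generalizing xs with
  | nil => exact ⟨[], by simpa [eq_comm] using h, rfl⟩
  | cons k s ih =>
    rw [List.sum_cons] at h
    obtain ⟨L, h1, h2⟩ := ih (xs.drop k) (by rw [List.length_drop]; omega)
    exact ⟨xs.take k :: L, by simp [h1], by simp [h2]; omega⟩

theorem sum_map_eq_sum_range {α : Type*} (l : List α) (F : α → ℝ) (H : ℕ → ℝ)
    (h : ∀ l₁ a l₂, l = l₁ ++ a :: l₂ → F a = H l₁.length) :
    (l.map F).sum = ∑ t ∈ Finset.range l.length, H t := by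
  induction l generalizing H with
  | nil => simp
  | cons a l ih =>
    rw [List.map_cons, List.sum_cons, List.length_cons, Finset.sum_range_succ',
      ih (fun t => H (t + 1)) fun l₁ b l₂ hl => h (a :: l₁) b l₂ (by rw [hl]; rfl), add_comm,
      h [] a l rfl]
    rfl

theorem sum_map_flatten {α : Type*} (L : List (List α)) (F : α → ℝ) (H : ℕ → ℝ)
    (h : ∀ l ∈ L, ∀ a ∈ l, F a = H l.length) :
    (L.flatten.map F).sum = ((L.map List.length).map fun j : ℕ => j * H j).sum := by
  induction L with
  | nil => simp
  | cons l L ih =>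
    rw [List.flatten_cons, List.map_append, List.sum_append, List.map_cons, List.map_cons,
      List.sum_cons, ih fun l' hl' => h l' (List.mem_cons_of_mem _ hl'),
      List.map_congr_left (h l List.mem_cons_self)]
    simp

theorem parts_mul_swap {d : ℕ} (σ : Perm (Fin d)) (i j : Fin d) :
    (σ * swap i j).partition.parts = (swap j i * σ).partition.parts := by
  rw [← (Perm.partition_eq_of_isConj (σ := σ * swap i j) (τ := swap j i * σ)).mp]
  exact isConj_iff.mpr ⟨swap i j, by rw [swap_inv, swap_comm j i]; simp [mul_assoc]⟩

/-- The cut-and-join rule.  In a permutation with cycle type `(k, β)` whose last symbol lies on a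
cycle of length `k`, multiplication by the transpositions moving the last symbol cuts that cycle
into `(a, k - a)`, once for each `0 < a < k`, and joins it with a cycle of length `j`, in `j` ways
for each such cycle. -/
theorem exists_perm_cut_join {n k : ℕ} {β : List ℕ} (hk : 0 < k) (hβ : ∀ j ∈ β, 0 < j)
    (hsum : k + β.sum = n + 1) :
    ∃ σ : Perm (Fin (n + 1)), σ.partition.parts = ((k :: β : List ℕ) : Multiset ℕ) ∧
      (2 ≤ k → σ (Fin.last n) ≠ Fin.last n) ∧
      ∀ G : Multiset ℕ → ℝ,
        ∑ i : Fin n, G (σ * swap i.castSucc (Fin.last n)).partition.parts =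
          ∑ a ∈ Finset.range (k - 1), G ((a + 1) ::ₘ (k - 1 - a) ::ₘ (β : Multiset ℕ)) +
          (β.map fun j : ℕ => j * G ((k + j) ::ₘ (β : Multiset ℕ).erase j)).sum := by
  -- Cut the list `n, …, 1, 0` into cycles, the first of which starts with the last symbol `n`.
  obtain ⟨L, hflat, hlen⟩ := exists_flatten_eq (k :: β) (List.finRange (n + 1)).reverse
    (by simp [hsum])
  have hnodup : L.flatten.Nodup := by
    rw [hflat, List.nodup_reverse]; exact List.nodup_finRange _
  have hne : [] ∉ L := fun h => by
    have h0 : 0 ∈ k :: β := hlen ▸ List.mem_map.mpr ⟨[], h, rfl⟩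
    rcases List.mem_cons.mp h0 with h0 | h0
    · omega
    · exact (hβ 0 h0).false
  rw [List.finRange_succ_last, List.reverse_append] at hflat
  obtain _ | ⟨_ | ⟨x, m⟩, R⟩ := L
  · simp at hlen
  · simp at hne
  obtain ⟨rfl, hmR⟩ : x = Fin.last n ∧
      m ++ R.flatten = ((List.finRange n).map Fin.castSucc).reverse := by
    simpa using hflat
  obtain ⟨hm, hR⟩ : m.length + 1 = k ∧ R.map List.length = β := by simpa using hlen
  have hcard (L : List (List (Fin (n + 1)))) (h : (L.map List.length).sum = n + 1) :
      L.flatten.length = Fintype.card (Fin (n + 1)) := by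
    rw [List.length_flatten, h, Fintype.card_fin]
  refine ⟨cyclePerm ((Fin.last n :: m) :: R), ?_, fun h2 => ?_, fun G => ?_⟩
  · rw [parts_partition_cyclePerm hnodup hne (hcard _ (by rw [hlen, List.sum_cons, hsum])), hlen]
  · rw [List.flatten_cons, List.nodup_append'] at hnodup
    rw [cyclePerm_cons, Perm.mul_apply,
      cyclePerm_apply_of_notMem (hnodup.2.2 List.mem_cons_self)]
    exact (List.formPerm_apply_mem_ne_self_iff _ hnodup.1 _ List.mem_cons_self).mpr (by simpa [hm])
  · have hFin (F : Fin (n + 1) → ℝ) :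
        ∑ i : Fin n, F i.castSucc = (m.map F).sum + (R.flatten.map F).sum := by
      rw [← List.sum_append, ← List.map_append, hmR, List.map_reverse, List.sum_reverse,
        List.map_map, Fin.sum_univ_def]
      rfl
    simp only [parts_mul_swap]
    rw [hFin fun i => G (swap (Fin.last n) i *
      cyclePerm ((Fin.last n :: m) :: R)).partition.parts]
    congr 1
    · rw [← hm, Nat.add_sub_cancel]
      refine sum_map_eq_sum_range m _ _ fun m₁ i m₂ hsplit => ?_
      subst hsplit
      have hmul : swap (Fin.last n) i * cyclePerm ((Fin.last n :: (m₁ ++ i :: m₂)) :: R) =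
          cyclePerm ((Fin.last n :: m₁) :: (i :: m₂) :: R) := by
        rw [List.flatten_cons, List.nodup_append'] at hnodup
        rw [cyclePerm_cons, ← List.cons_append, ← swap_mul_formPerm_mul_formPerm hnodup.1,
          swap_comm i, ← mul_assoc, ← mul_assoc (swap _ _), swap_mul_self, one_mul,
          cyclePerm_cons, cyclePerm_cons, mul_assoc]
      rw [hmul, parts_partition_cyclePerm (by simpa using hnodup) (by simpa using hne)
        (hcard _ (by simp [← hsum, ← hm, ← hR]; omega)), ← hR]
      simp only [List.map_cons, List.length_cons, List.length_append, ← Multiset.cons_coe]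
      congr 3
      omega
    · rw [← hR]
      refine sum_map_flatten R _ _ fun B hB i hi => ?_
      obtain ⟨R', hR'⟩ : ∃ R', R.Perm (B :: R') := ⟨_, List.perm_cons_erase hB⟩
      obtain ⟨u, v, rfl⟩ := List.append_of_mem hi
      have hnodup₁ := (hR'.cons (Fin.last n :: m)).flatten.nodup_iff.mp hnodup
      have hrot : (u ++ i :: v).formPerm = (i :: (v ++ u)).formPerm :=
        List.formPerm_eq_of_isRotated
          ((List.nodup_flatten.mp hnodup₁).1 _ (List.mem_cons_of_mem _ List.mem_cons_self))
          List.isRotated_append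
      have hperm : ((Fin.last n :: m) ++ i :: (v ++ u) ++ R'.flatten).Perm
          ((Fin.last n :: m) :: (u ++ i :: v) :: R').flatten := by
        rw [List.flatten_cons, List.flatten_cons, List.append_assoc]
        exact (List.perm_append_comm (l₁ := i :: v).append_right _).append_left _
      have hnodup₂ := hperm.nodup_iff.mpr hnodup₁
      have hmul : swap (Fin.last n) i * cyclePerm ((Fin.last n :: m) :: R) =
          cyclePerm ((Fin.last n :: m ++ i :: (v ++ u)) :: R') := by
        rw [cyclePerm_eq_of_perm hnodup (hR'.cons _), cyclePerm_cons, cyclePerm_cons,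
          cyclePerm_cons, hrot, swap_comm,
          ← swap_mul_formPerm_mul_formPerm (List.nodup_append'.mp hnodup₂).1]
        simp only [mul_assoc]
      have hlen' := hR'.map List.length
      rw [hR, List.map_cons] at hlen'
      have hsum' := hlen'.sum_eq
      have hne' : [] ∉ R' := fun h =>
        hne (List.mem_cons_of_mem _ (hR'.mem_iff.mpr (List.mem_cons_of_mem _ h)))
      rw [hmul, parts_partition_cyclePerm (by simpa using hnodup₂) (by simpa using hne')
        (hcard _ (by simp at hsum' ⊢; omega)), hR, Multiset.coe_eq_coe.mpr hlen',
        ← Multiset.cons_coe _ (R'.map _), Multiset.erase_cons_head, List.map_cons,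
        ← Multiset.cons_coe]
      congr 2
      simp [← hm]
      omega

/-! ### A maximum principle for the linear system -/

theorem parts_partition_one (n : ℕ) :
    (1 : Perm (Fin n)).partition.parts = Multiset.replicate n 1 := by
  simp [Perm.parts_partition]

/-- An approximate solution `V` of the cut-and-join equations in degree `n + 1` is close to
`σ ↦ walkGF N (n + 1) σ`, up to the common scale fixed by the value at the identity.  The sum of
the coefficients on the right-hand side of an equation is `n < N`, so the error at a permutation
where it is largest is controlled by the residual `ε` there. -/
theorem abs_walkGF_sub_le {N n : ℕ} (hn : n < N) (V : Multiset ℕ → ℝ) {ε : ℝ} (hε : 0 ≤ ε)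
    (hV : ∀ (k : ℕ) (β : List ℕ), 2 ≤ k → (k :: β).Pairwise (· ≥ ·) → (∀ j ∈ β, 0 < j) →
      k + β.sum = n + 1 →
      |(N : ℝ) * V ((k :: β : List ℕ) : Multiset ℕ) -
        (∑ a ∈ Finset.range (k - 1), V ((a + 1) ::ₘ (k - 1 - a) ::ₘ (β : Multiset ℕ)) +
          (β.map fun j : ℕ => j * V ((k + j) ::ₘ (β : Multiset ℕ).erase j)).sum)| ≤ ε)
    (σ : Perm (Fin (n + 1))) :
    |walkGF N (n + 1) (toPermNat (n + 1) σ) * V (Multiset.replicate (n + 1) 1) -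
      walkGF N (n + 1) 1 * V σ.partition.parts| ≤ ε * walkGF N (n + 1) 1 := by
  set w₁ := walkGF N (n + 1) 1
  set V₁ := V (Multiset.replicate (n + 1) 1)
  have hw₁ : 0 < w₁ := walkGF_one_pos hn
  let D : Perm (Fin (n + 1)) → ℝ := fun τ =>
    walkGF N (n + 1) (toPermNat (n + 1) τ) * V₁ - w₁ * V τ.partition.parts
  have hDconj {τ τ' : Perm (Fin (n + 1))} (h : τ.partition.parts = τ'.partition.parts) :
      D τ = D τ' := by
    simp only [D, h, walkGF_eq_of_isConj (isConj_of_parts_eq h)]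
  obtain ⟨σ₀, hσ₀⟩ := Finite.exists_max fun τ => |D τ|
  refine (hσ₀ σ).trans ?_
  -- The first part of the decreasing list is the largest one, so it exceeds `1` unless `σ₀ = 1`.
  obtain ⟨l, hl, hsort⟩ : ∃ l : List ℕ, (l : Multiset ℕ) = σ₀.partition.parts ∧
      l.Pairwise (· ≥ ·) :=
    ⟨_, Multiset.sort_eq _ _, Multiset.pairwise_sort σ₀.partition.parts (· ≥ ·)⟩
  have hpos : ∀ j ∈ l, 0 < j := fun j hj =>
    σ₀.partition.parts_pos (by rw [← hl]; exact hj)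
  have hsum : l.sum = n + 1 := by
    rw [← Multiset.sum_coe, hl, σ₀.partition.parts_sum, Fintype.card_fin]
  obtain _ | ⟨k, β⟩ := l
  · simp at hsum
  rcases Nat.lt_or_ge k 2 with hk | hk
  · have hone : ∀ j ∈ k :: β, j = 1 := fun j hj => by
      have h1 := hpos j hj
      rcases List.mem_cons.mp hj with rfl | hj
      · omega
      · have h2 := (List.pairwise_cons.mp hsort).1 j hj
        omega
    have hrep := List.eq_replicate_of_mem hone
    have hlen : (k :: β).length = n + 1 := by rw [← hsum, hrep]; simp
    have hD : D σ₀ = D 1 := hDconj (by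
      rw [← hl, parts_partition_one, hrep, hlen, Multiset.coe_replicate])
    have hD1 : D 1 = 0 := by
      simp only [D, parts_partition_one, map_one]
      ring
    rw [hD, hD1, abs_zero]
    positivity
  · have hposβ : ∀ j ∈ β, 0 < j := fun j hj => hpos j (List.mem_cons_of_mem _ hj)
    rw [List.sum_cons] at hsum
    obtain ⟨τ, hτ, hfix, hG⟩ := exists_perm_cut_join (by omega : 0 < k) hposβ hsum
    have hD : D σ₀ = D τ := hDconj (hl.symm.trans hτ.symm)
    -- `τ` moves the last symbol, so the inhomogeneous term of its equation vanishes.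
    have hfix' : toPermNat (n + 1) τ n ≠ n := by
      have h := toPermNat_apply τ (Fin.last n)
      rw [Fin.val_last] at h
      rw [h]
      exact fun h' => hfix hk (Fin.ext h')
    have hsys := walkGF_succ hn (toPermNat (n + 1) τ)
    rw [walkGF_eq_zero le_rfl hfix', mul_zero, zero_add, ← Fin.sum_univ_eq_sum_range
      (fun i => walkGF N (n + 1) (toPermNat (n + 1) τ * swap i n))] at hsys
    have hres := hV k β hk hsort hposβ hsum
    rw [← hG V, ← hτ] at hres
    have hND : (N : ℝ) * D τ = ∑ i : Fin n, D (τ * swap i.castSucc (Fin.last n)) -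
        w₁ * (N * V τ.partition.parts -
          ∑ i : Fin n, V (τ * swap i.castSucc (Fin.last n)).partition.parts) := by
      simp only [D, Finset.sum_sub_distrib, ← Finset.sum_mul, ← Finset.mul_sum, map_mul,
        toPermNat_swap, Fin.val_castSucc, Fin.val_last]
      rw [mul_sub, ← mul_assoc, hsys]
      ring
    have hsumD : |∑ i : Fin n, D (τ * swap i.castSucc (Fin.last n))| ≤ n * |D σ₀| := by
      refine (Finset.abs_sum_le_sum_abs _ _).trans
        ((Finset.sum_le_sum fun i _ => hσ₀ _).trans_eq ?_)
      simp
    have hNabs : (N : ℝ) * |D τ| ≤ n * |D σ₀| + w₁ * ε := by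
      rw [← Nat.abs_cast N, ← abs_mul, hND]
      refine (abs_sub _ _).trans (add_le_add hsumD ?_)
      rw [abs_mul, abs_of_pos hw₁]
      gcongr
    have hN : (n : ℝ) + 1 ≤ N := by exact_mod_cast hn
    rw [← hD] at hNabs
    nlinarith [abs_nonneg (D σ₀)]

theorem parts_partition_swap {n : ℕ} {i j : Fin (n + 1)} (h : i ≠ j) :
    (swap i j).partition.parts = 2 ::ₘ Multiset.replicate (n - 1) 1 := by
  rw [Perm.parts_partition, (Perm.IsSwap.isCycle ⟨i, j, h, rfl⟩).cycleType,
    Perm.card_support_swap h, Fintype.card_fin, Multiset.singleton_add]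
  rfl

/-- The equation of the linear system at the identity. -/
theorem walkGF_succ_one {N n : ℕ} (hn : n < N) {τ : Perm (Fin (n + 1))}
    (hτ : τ.partition.parts = 2 ::ₘ Multiset.replicate (n - 1) 1) :
    N * walkGF N (n + 1) 1 =
      N * walkGF N n 1 + n * walkGF N (n + 1) (toPermNat (n + 1) τ) := by
  rw [walkGF_succ hn 1, ← Fin.sum_univ_eq_sum_range
    (fun i => walkGF N (n + 1) (1 * swap i n)), Finset.sum_congr rfl (g := fun _ =>
      walkGF N (n + 1) (toPermNat (n + 1) τ))]
  · simp
  · intro i _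
    have hne : i.castSucc ≠ Fin.last n := (Fin.castSucc_lt_last i).ne
    have hconj := isConj_of_parts_eq (hτ.trans (parts_partition_swap hne).symm)
    rw [one_mul, walkGF_eq_of_isConj hconj, toPermNat_swap]
    rfl

/-! ### Verification of tabulated solutions -/

/-- A finite table of natural numbers, organised as a binary search tree. -/
inductive Table where
  | nil : Table
  | node (key value : ℕ) (left right : Table) : Table

/-- The value stored at a key, and `0` if there is none. -/
def Table.get : Table → ℕ → ℕ
  | .nil, _ => 0
  | .node k v l r, x => bif Nat.beq x k then v else bif Nat.blt x k then l.get x else r.get x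

/-- The key of a partition in a table is the sum of the weights of its parts.  The base and the
modulus make the keys small, and distinct for the partitions that the tables list; the
verification of a table does not depend on this. -/
def partWeight (k : ℕ) : ℕ := 49 ^ k % 620

/-- The key of a partition that is given as a list. -/
def keySum : List ℕ → ℕ
  | [] => 0
  | k :: l => partWeight k + keySum l

/-- The value that a table assigns to the multiset of the parts of a partition. -/
def Table.eval (T : Table) (s : Multiset ℕ) : ℕ := T.get (s.map partWeight).sum

theorem keySum_eq (l : List ℕ) : keySum l = ((l : Multiset ℕ).map partWeight).sum := by
  induction l with
  | nil => rfl
  | cons k l ih => rw [keySum, ih]; simp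

/-- `∑_{0 < a ≤ c} T(a, k - a, β)`, where `b` is the key of `β`. -/
def cutSum (T : Table) (k b : ℕ) : ℕ → ℕ
  | 0 => 0
  | c + 1 => T.get (partWeight (c + 1) + (partWeight (k - 1 - c) + b)) + cutSum T k b c

/-- `∑_{j ∈ l} j T(k + j, β - j)`, where `b` is the key of `β`. -/
def joinSum (T : Table) (k b : ℕ) : List ℕ → ℕ
  | [] => 0
  | j :: l => j * T.get (partWeight (k + j) + (b - partWeight j)) + joinSum T k b l

/-- The cut-and-join equation at `(k, β)` holds for `T` up to an error of `ε`. -/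
def residualLE (T : Table) (N ε : ℕ) : List ℕ → Bool
  | [] => true
  | k :: β => Nat.ble k 1 ||
      (Nat.ble (N * T.get (keySum (k :: β)))
          (cutSum T k (keySum β) (k - 1) + joinSum T k (keySum β) β + ε) &&
        Nat.ble (cutSum T k (keySum β) (k - 1) + joinSum T k (keySum β) β)
          (N * T.get (keySum (k :: β)) + ε))

/-- The partitions of `s` into parts of size at most `m`, as weakly decreasing lists, provided that
`m + s` does not exceed the first argument, which bounds the depth of the recursion. -/
def boundedPartitions : ℕ → ℕ → ℕ → List (List ℕ)
  | _, _, 0 => [[]]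
  | 0, _, _ + 1 => []
  | _ + 1, 0, _ + 1 => []
  | f + 1, m + 1, s + 1 =>
    (bif Nat.ble m s then (boundedPartitions f (m + 1) (s - m)).map (List.cons (m + 1)) else []) ++
      boundedPartitions f m (s + 1)

theorem mem_boundedPartitions {f m s : ℕ} {l : List ℕ} (hf : m + s ≤ f)
    (hl : l.Pairwise (· ≥ ·)) (hpos : ∀ j ∈ l, 0 < j) (hm : ∀ j ∈ l, j ≤ m) (hs : l.sum = s) :
    l ∈ boundedPartitions f m s := by
  induction f generalizing m s l with
  | zero =>
    obtain rfl : s = 0 := by omega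
    cases l with
    | nil => simp [boundedPartitions]
    | cons k l =>
      have := hpos k List.mem_cons_self
      rw [List.sum_cons] at hs
      omega
  | succ f ih =>
    cases l with
    | nil =>
      obtain rfl : 0 = s := hs
      simp [boundedPartitions]
    | cons k l =>
      have hk0 := hpos k List.mem_cons_self
      have hkm := hm k List.mem_cons_self
      rw [List.sum_cons] at hs
      obtain _ | m := m
      · omega
      obtain _ | s := s
      · omega
      rw [boundedPartitions, List.mem_append]
      rcases hkm.eq_or_lt with rfl | hlt
      · left
        have hms : Nat.ble m s = true := Nat.ble_eq.mpr (by omega)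
        rw [hms, cond_true]
        have hl' := List.pairwise_cons.mp hl
        exact List.mem_map_of_mem (ih (by omega) hl'.2
          (fun j hj => hpos j (List.mem_cons_of_mem _ hj)) hl'.1 (by omega))
      · right
        refine ih (by omega) hl hpos (fun j hj => ?_) (by rw [List.sum_cons]; exact hs)
        rcases List.mem_cons.mp hj with rfl | hj
        · omega
        · have := (List.pairwise_cons.mp hl).1 j hj
          omega

/-- The partitions of `d` as weakly decreasing lists. -/
def partitionList (d : ℕ) : List (List ℕ) := boundedPartitions (d + d) d d

theorem mem_partitionList {d : ℕ} {l : List ℕ} (hl : l.Pairwise (· ≥ ·)) (hpos : ∀ j ∈ l, 0 < j)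
    (hs : l.sum = d) : l ∈ partitionList d :=
  mem_boundedPartitions le_rfl hl hpos (fun _ hj => hs ▸ List.le_sum_of_mem hj) hs

/-- `T` is positive at the identity and solves the cut-and-join equations in degree `d` up to an
error of `ε`.  Since `partWeight 1 = 49`, the key of `(1^d)` is `49 d`. -/
def Table.verify (T : Table) (N ε d : ℕ) : Bool :=
  Nat.blt 0 (T.get (d * 49)) && (partitionList d).all (residualLE T N ε)

theorem eval_replicate_one (T : Table) (d : ℕ) :
    T.eval (Multiset.replicate d 1) = T.get (d * 49) := by
  rw [Table.eval, Multiset.map_replicate, Multiset.sum_replicate]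
  rfl

theorem cutSum_eq (T : Table) (k : ℕ) (β : List ℕ) (c : ℕ) :
    cutSum T k (keySum β) c =
      ∑ a ∈ Finset.range c, T.eval ((a + 1) ::ₘ (k - 1 - a) ::ₘ (β : Multiset ℕ)) := by
  induction c with
  | zero => rfl
  | succ c ih =>
    rw [cutSum, ih, Finset.sum_range_succ, add_comm, Table.eval, Multiset.map_cons,
      Multiset.sum_cons, Multiset.map_cons, Multiset.sum_cons, keySum_eq]

theorem joinSum_eq (T : Table) (k : ℕ) (β l : List ℕ) (h : ∀ j ∈ l, j ∈ β) :
    joinSum T k (keySum β) l =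
      (l.map fun j => j * T.eval ((k + j) ::ₘ (β : Multiset ℕ).erase j)).sum := by
  induction l with
  | nil => rfl
  | cons j l ih =>
    have hj := Multiset.sum_map_erase (f := partWeight)
      (Multiset.mem_coe.mpr (h j List.mem_cons_self))
    rw [joinSum, ih fun i hi => h i (List.mem_cons_of_mem _ hi), List.map_cons, List.sum_cons,
      Table.eval, Multiset.map_cons, Multiset.sum_cons, keySum_eq, ← hj, Nat.add_sub_cancel_left]

theorem Table.eval_one_pos {T : Table} {N ε d : ℕ} (h : T.verify N ε d = true) :
    0 < T.eval (Multiset.replicate d 1) := by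
  rw [Table.verify, Bool.and_eq_true] at h
  rw [eval_replicate_one]
  exact Nat.le_of_ble_eq_true h.1

theorem abs_walkGF_sub_le_of_verify {T : Table} {N ε n : ℕ} (hn : n < N)
    (h : T.verify N ε (n + 1) = true) (σ : Perm (Fin (n + 1))) :
    |walkGF N (n + 1) (toPermNat (n + 1) σ) * T.eval (Multiset.replicate (n + 1) 1) -
      walkGF N (n + 1) 1 * T.eval σ.partition.parts| ≤ ε * walkGF N (n + 1) 1 := by
  refine abs_walkGF_sub_le hn (fun s => (T.eval s : ℝ)) ε.cast_nonneg
    (fun k β hk hsort hpos hsum => ?_) σ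
  rw [Table.verify, Bool.and_eq_true, List.all_eq_true] at h
  have hmem : k :: β ∈ partitionList (n + 1) := mem_partitionList hsort (fun j hj => by
    rcases List.mem_cons.mp hj with rfl | hj
    · omega
    · exact hpos j hj) (by rw [List.sum_cons, hsum])
  have hres := h.2 _ hmem
  rw [residualLE, Bool.or_eq_true, Bool.and_eq_true, Nat.ble_eq, Nat.ble_eq, Nat.ble_eq,
    cutSum_eq, joinSum_eq T k β β fun _ => id, keySum_eq] at hres
  obtain ⟨h1, h2⟩ := hres.resolve_left (by omega)
  rw [← Table.eval] at h1 h2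
  have h1' : ((N * T.eval ((k :: β : List ℕ) : Multiset ℕ) : ℕ) : ℝ) ≤ _ := Nat.cast_le.mpr h1
  have h2' : _ ≤ ((N * T.eval ((k :: β : List ℕ) : Multiset ℕ) + ε : ℕ) : ℝ) := Nat.cast_le.mpr h2
  push_cast [Nat.cast_list_sum, List.map_map, Function.comp_def] at h1' h2'
  rw [abs_le]
  constructor <;> linarith

/-! ### Tables -/

section Tables

open Table

/-- The exact solution in degree `1` for `N = 1`, scaled to integers. -/
def table1 : Table :=
  node 49 1 nil nil

/-- The exact solution in degree `2` for `N = 2`, scaled to integers. -/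
def table2 : Table :=
  node 541 1 (node 98 2 nil nil) nil

/-- The exact solution in degree `2` for `N = 13`, scaled to integers. -/
def table2At13 : Table :=
  node 541 1 (node 98 13 nil nil) nil

/-- The exact solution in degree `3` for `N = 3`, scaled to integers. -/
def table3 : Table :=
  node 469 2 (node 147 7 nil nil) (node 590 3 nil nil)

/-- The exact solution in degree `3` for `N = 13`, scaled to integers. -/
def table3At13 : Table :=
  node 469 2 (node 147 167 nil nil) (node 590 13 nil nil)

/-- The exact solution in degree `4` for `N = 4`, scaled to integers. -/
def table4 : Table :=
  node 518 29 (node 196 134 (node 41 20 nil nil) nil) (node 1082 22 (node 639 48 nil nil) nil)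

/-- The exact solution in degree `4` for `N = 13`, scaled to integers. -/
def table4At13 : Table :=
  node 518 67 (node 196 5443 (node 41 13 nil nil) nil) (node 1082 35 (node 639 429 nil nil) nil)

/-- The exact solution in degree `5` for `N = 5`, scaled to integers. -/
def table5 : Table :=
  node 567 160 (node 149 70 (node 90 101 nil nil) (node 245 1015 nil nil)) (node 1010 74 (node 688
  299 nil nil) (node 1131 115 nil nil))

/-- The exact solution in degree `5` for `N = 13`, scaled to integers. -/
def table5At13 : Table :=
  node 567 4160 (node 149 182 (node 90 821 nil nil) (node 245 328367 nil nil)) (node 1010 362 (node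
  688 26219 nil nil) (node 1131 2171 nil nil))

/-- The exact solution in degree `6` for `N = 6`, scaled to integers. -/
def table6 : Table :=
  node 616 3540 (node 294 31524 (node 198 1274 (node 139 2004 nil nil) nil) (node 582 922 (node 481
  882 nil nil) nil)) (node 1059 1377 (node 938 900 (node 737 7614 nil nil) nil) (node 1623 1014
  (node 1180 2396 nil nil) nil))

/-- The exact solution in degree `6` for `N = 13`, scaled to integers. -/
def table6At13 : Table :=
  node 616 57192 (node 294 4379862 (node 198 2597 (node 139 11492 nil nil) nil) (node 582 1080
  (node 481 637 nil nil) nil)) (node 1059 5070 (node 938 927 (node 737 354510 nil nil) nil) (node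
  1623 2626 (node 1180 29818 nil nil) nil))

/-- The exact solution in degree `7` for `N = 7`, scaled to integers. -/
def table7 : Table :=
  node 665 14770 (node 343 184849 (node 188 7369 (node 9 1848 nil nil) (node 247 4214 nil nil))
  (node 530 2676 (node 510 1870 nil nil) (node 631 2849 nil nil))) (node 1108 4704 (node 786 36957
  (node 690 1922 nil nil) (node 987 2758 nil nil)) (node 1551 2030 (node 1229 9401 nil nil) (node
  1672 3261 nil nil)))

/-- The exact solution in degree `7` for `N = 13`, scaled to integers. -/
def table7At13 : Table :=
  node 665 89700 (node 343 6653478 (node 188 18372 (node 9 286 nil nil) (node 247 4238 nil nil))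
  (node 530 1063 (node 510 360 nil nil) (node 631 1768 nil nil))) (node 1108 8112 (node 786 546306
  (node 690 436 nil nil) (node 987 1521 nil nil)) (node 1551 780 (node 1229 46722 nil nil) (node
  1672 4198 nil nil)))

/-- The exact solution in degree `8` for `N = 8`, scaled to integers. -/
def table8 : Table :=
  node 739 15808 (node 441 10296 (node 237 81680 (node 82 10348 (node 58 14949 nil nil) nil) (node
  392 3245092 (node 296 41332 nil nil) nil)) (node 618 10387 (node 579 23616 (node 559 15224 nil
  nil) nil) (node 714 187642 (node 680 25824 nil nil) nil))) (node 1278 112828 (node 1036 24718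
  (node 1022 10674 (node 835 546368 nil nil) nil) (node 1157 48224 (node 1123 11152 nil nil) nil))
  (node 1721 31296 (node 1600 17122 (node 1479 10880 nil nil) nil) (node 2164 12276 nil nil)))

/-- The exact solution in degree `8` for `N = 13`, scaled to integers. -/
def table8At13 : Table :=
  node 739 103220 (node 441 20449 (node 237 4124211 (node 82 22833 (node 58 69091 nil nil) nil)
  (node 392 1414666485 (node 296 972660 nil nil) nil)) (node 618 23745 (node 579 249964 (node 559
  85683 nil nil) nil) (node 714 19728705 (node 680 407341 nil nil) nil))) (node 1278 10266693 (node
  1036 351348 (node 1022 28666 (node 835 117926055 nil nil) nil) (node 1157 1823133 (node 1123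
  43667 nil nil) nil)) (node 1721 942799 (node 1600 180165 (node 1479 37986 nil nil) nil) (node
  2164 92677 nil nil)))

/-- The exact solution in degree `9` for `N = 9`, scaled to integers. -/
def table9 : Table :=
  node 884 67963995 (node 529 424710 (node 286 7671285 (node 131 623287 (node 107 980100 nil nil)
  (node 190 425970 nil nil)) (node 441 470154855 (node 345 3403450 nil nil) (node 490 618189 nil
  nil))) (node 667 626755 (node 608 1008288 (node 550 439230 nil nil) (node 628 1722033 nil nil))
  (node 763 20217300 (node 729 1953809 nil nil) (node 788 1061940 nil nil)))) (node 1327 11589715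
  (node 1085 1843479 (node 1051 444158 (node 950 427806 nil nil) (node 1071 650997 nil nil)) (node
  1206 4200174 (node 1172 694281 nil nil) (node 1231 456670 nil nil))) (node 1770 2554047 (node
  1528 670923 (node 1407 434298 nil nil) (node 1649 1193824 nil nil)) (node 2213 800223 (node 2092
  482274 nil nil) nil)))

/-- The exact solution in degree `9` for `N = 13`, scaled to integers. -/
def table9At13 : Table :=
  node 884 7964715187 (node 529 531674 (node 286 290506697 (node 131 1784351 (node 107 5275842 nil
  nil) (node 190 562042 nil nil)) (node 441 94025351747 (node 345 70181862 nil nil) (node 490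
  1615471 nil nil))) (node 667 1851117 (node 608 6441344 (node 550 692120 nil nil) (node 628
  18523596 nil nil)) (node 763 1359420812 (node 729 29532701 nil nil) (node 788 7712562 nil nil))))
  (node 1327 706836127 (node 1085 25550096 (node 1051 805574 (node 950 586248 nil nil) (node 1071
  2215590 nil nil)) (node 1206 128628214 (node 1172 3289949 nil nil) (node 1231 945942 nil nil)))
  (node 1770 66483807 (node 1528 2874586 (node 1407 712820 nil nil) (node 1649 13107520 nil nil))
  (node 2213 6745995 (node 2092 1474434 nil nil) nil)))

/-- The exact solution in degree `10` for `N = 10`, scaled to integers. -/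
def table10 : Table :=
  node 979 3528656 (node 539 8068060 (node 394 63643070 (node 239 5096688 (node 180 8177548 (node
  156 14241227 nil nil) nil) (node 335 163677908 (node 298 3481090 nil nil) nil)) (node 501 3476330
  (node 490 14921091500 (node 478 3498209 nil nil) nil) (node 522 3483674 nil nil))) (node 716
  8245055 (node 623 3604694 (node 599 5323890 (node 578 5071352 nil nil) nil) (node 677 28270646
  (node 657 14874962 nil nil) nil)) (node 837 15958437 (node 812 491662340 (node 778 33626034 nil
  nil) nil) (node 933 1885439022 nil nil)))) (node 1456 5254493 (node 1159 3617937 (node 1100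
  5421351 (node 999 5129957 (node 982 3587870 nil nil) nil) (node 1134 31203344 (node 1120 8693892
  nil nil) nil)) (node 1280 5638920 (node 1255 83860827 (node 1221 9559940 nil nil) nil) (node 1376
  271595980 nil nil))) (node 1819 48163646 (node 1664 3885410 (node 1577 9118266 (node 1563 3718846
  nil nil) nil) (node 1698 18884086 nil nil)) (node 2262 11777820 (node 2141 6127457 (node 2020
  3788320 nil nil) nil) (node 2705 4286110 nil nil))))

/-- The exact solution in degree `10` for `N = 13`, scaled to integers. -/
def table10At13 : Table :=
  node 979 1913407 (node 539 12808510 (node 394 502065551 (node 239 4624933 (node 180 13989508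
  (node 156 40225614 nil nil) nil) (node 335 2023968358 (node 298 1677806 nil nil) nil)) (node 501
  1643356 (node 490 615326060596 (node 478 1746888 nil nil) nil) (node 522 1689909 nil nil))) (node
  716 14473550 (node 623 2116060 (node 599 5603026 (node 578 4409548 nil nil) nil) (node 677
  136515147 (node 657 48306712 nil nil) nil)) (node 837 57431867 (node 812 9247276090 (node 778
  212558138 nil nil) nil) (node 933 53023405332 nil nil)))) (node 1456 5711251 (node 1159 2172416
  (node 1100 6408506 (node 999 4803915 (node 982 1996566 nil nil) nil) (node 1134 184547077 (node
  1120 17151849 nil nil) nil)) (node 1280 7451483 (node 1255 898169856 (node 1221 24766274 nil nil)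
  nil) (node 1376 4804643168 nil nil))) (node 1819 464158320 (node 1664 3325686 (node 1577 21754683
  (node 1563 2500851 nil nil) nil) (node 1698 94795610 nil nil)) (node 2262 48859980 (node 2141
  11211888 (node 2020 2970461 nil nil) nil) (node 2705 5805036 nil nil))))

/-- The exact solution in degree `11` for `N = 11`, scaled to integers. -/
def table11 : Table :=
  node 1031 40437111 (node 627 61633286 (node 443 1264851752 (node 288 62154488 (node 205 218176090
  (node 50 26463998 nil nil) (node 229 111693935 nil nil)) (node 369 26420108 (node 347 38712502
  nil nil) (node 384 3687171433 nil nil))) (node 551 26658482 (node 539 481238622227 (node 527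
  39008332 nil nil) (node 550 38618866 nil nil)) (node 588 109290467 (node 571 38758729 nil nil)
  nil))) (node 765 113040161 (node 706 232753114 (node 648 66147796 (node 630 26441426 nil nil)
  (node 672 40765659 nil nil)) (node 731 27294562 (node 726 493371461 nil nil) nil)) (node 910
  26566826 (node 861 12494643986 (node 827 620402077 nil nil) (node 886 255262986 nil nil)) (node
  1028 39566263 (node 982 53971856191 nil nil) nil)))) (node 1505 65228276 (node 1183 565697963
  (node 1091 28146558 (node 1070 27219478 (node 1048 62771456 nil nil) (node 1087 26741018 nil
  nil)) (node 1169 121584421 (node 1149 68130448 nil nil) nil)) (node 1329 72027612 (node 1270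
  139501725 (node 1208 40996395 nil nil) (node 1304 1789398820 nil nil)) (node 1491 27408790 (node
  1425 6715635527 nil nil) nil))) (node 1868 982567355 (node 1713 45600889 (node 1612 42648485
  (node 1592 28451478 nil nil) (node 1626 130874887 nil nil)) (node 1772 29267150 (node 1747
  322199414 nil nil) nil)) (node 2311 187699627 (node 2069 43981331 (node 1948 27808858 nil nil)
  (node 2190 81706064 nil nil)) (node 2754 53039591 (node 2633 30928762 nil nil) nil))))

/-- The exact solution in degree `11` for `N = 13`, scaled to integers. -/
def table11At13 : Table :=
  node 1031 15480062 (node 627 32963788 (node 443 3151085518 (node 288 34297458 (node 205 271725270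
  (node 50 5751330 nil nil) (node 229 97854700 nil nil)) (node 369 5677048 (node 347 13304538 nil
  nil) (node 384 12332801338 nil nil))) (node 551 6035848 (node 539 3502434174748 (node 527
  13762698 nil nil) (node 550 13089388 nil nil)) (node 588 90650586 (node 571 13383681 nil nil)
  nil))) (node 765 100927408 (node 706 320595340 (node 648 40769014 (node 630 5719038 nil nil)
  (node 672 16227692 nil nil)) (node 731 6610020 (node 726 886362243 nil nil) nil)) (node 910
  5875116 (node 861 54883971448 (node 827 1344709770 nil nil) (node 886 377955500 nil nil)) (node
  1028 14828671 (node 982 307414609060 nil nil) nil)))) (node 1505 41149672 (node 1183 1172492233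
  (node 1091 7502558 (node 1070 6465940 (node 1048 35458176 nil nil) (node 1087 6133138 nil nil))
  (node 1169 118203099 (node 1149 45767520 nil nil) nil)) (node 1329 52584122 (node 1270 165425702
  (node 1208 16599050 nil nil) (node 1304 5490167800 nil nil)) (node 1491 6758922 (node 1425
  28500875872 nil nil) nil))) (node 1868 2838389424 (node 1713 24127326 (node 1612 18816135 (node
  1592 8054228 nil nil) (node 1626 146269669 nil nil)) (node 1772 8964384 (node 1747 603869512 nil
  nil) nil)) (node 2311 312230340 (node 2069 21764053 (node 1948 7411378 nil nil) (node 2190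
  76016928 nil nil)) (node 2754 39760188 (node 2633 11633496 nil nil) nil))))

/-- The exact solution in degree `12` for `N = 12`, scaled to integers. -/
def table12 : Table :=
  node 1077 6394346250 (node 676 10946223288 (node 433 1220850895752 (node 254 50014343379 (node
  123 2633735712 (node 101 2622796176 (node 99 3851609333 nil nil) nil) (node 158 2624260639 nil
  nil)) (node 396 6173076482 (node 337 11100076422 (node 278 22733645364 nil nil) nil) (node 418
  3840522972 nil nil))) (node 599 6146657088 (node 576 6246620523 (node 492 373236432072 (node 482
  2626395200 nil nil) nil) (node 588 220266633568212 nil nil)) (node 637 21977692880 (node 620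
  6184947840 (node 600 3898469862 nil nil) nil) (node 659 2641084005 nil nil)))) (node 910
  4616009386110 (node 775 128745157428 (node 721 6667513984 (node 697 12114813997 (node 679
  3846182483 nil nil) nil) (node 755 54820986780 nil nil)) (node 839 2701306906 (node 814
  23120011485 (node 780 4031994752 nil nil) nil) (node 876 172063120512 nil nil))) (node 1019
  2714167885 (node 962 2623823202 (node 959 3875063192 (node 935 61575683866 nil nil) nil) (node
  998 2635801740 nil nil)) (node 1042 2697884904 (node 1031 22202227285776 nil nil) (node 1063
  2703217654 nil nil))))) (node 1641 4296781072 (node 1257 6725557267 (node 1140 4218149507 (node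
  1119 4012227648 (node 1097 11264770797 (node 1080 6575089664 nil nil) nil) (node 1136 3917171829
  nil nil)) (node 1218 25472533158 (node 1198 12696944832 (node 1164 2796727220 nil nil) nil) (node
  1232 154256723694 nil nil))) (node 1474 2432300520228 (node 1378 13710548208 (node 1353
  567959645682 (node 1319 30850693600 nil nil) nil) (node 1419 2650301094 nil nil)) (node 1540
  4058666541 (node 1523 2784246608 (node 1520 2736837888 nil nil) nil) (node 1554 11964805497 nil
  nil)))) (node 2104 2886322938 (node 1796 83695306410 (node 1700 2806873785 (node 1675 28403001216
  (node 1661 7117524992 nil nil) nil) (node 1762 7882034304 nil nil)) (node 1917 301893736728 (node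
  1876 2680783254 (node 1821 4478012378 nil nil) nil) (node 1997 4158344601 nil nil))) (node 2561
  2939755956 (node 2239 16506680166 (node 2205 3017307448 (node 2118 7488477210 nil nil) nil) (node
  2360 46085384916 nil nil)) (node 2803 9909876608 (node 2682 4888429974 nil nil) (node 3246
  3340245924 nil nil)))))

/-- The exact solution in degree `12` for `N = 13`, scaled to integers. -/
def table12At13 : Table :=
  node 1077 1478503710 (node 676 3108482572 (node 433 903011061867 (node 254 22487704291 (node 123
  342906847 (node 101 337784356 (node 99 647956993 nil nil) nil) (node 158 338535106 nil nil))
  (node 396 1359619378 (node 337 3207436062 (node 278 8484462441 nil nil) nil) (node 418 642161468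
  nil nil))) (node 599 1343518228 (node 576 1396326412 (node 492 238684056338 (node 482 339459315
  nil nil) nil) (node 588 237867300810373 nil nil)) (node 637 7958418845 (node 620 1365852930 (node
  600 670714473 nil nil) nil) (node 659 345664455 nil nil)))) (node 910 3901925475565 (node 775
  69885897838 (node 721 1596362679 (node 697 3725850887 (node 679 645355118 nil nil) nil) (node 755
  26025222855 nil nil)) (node 839 364997726 (node 814 8719050665 (node 780 721100458 nil nil) nil)
  (node 876 102977383873 nil nil))) (node 1019 370275950 (node 962 338334178 (node 959 658247837
  (node 935 30362910086 nil nil) nil) (node 998 343093660 nil nil)) (node 1042 363181676 (node 1031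
  21298965812771 nil nil) (node 1063 365841964 nil nil))))) (node 1641 839753947 (node 1257
  1625939207 (node 1140 797122703 (node 1119 710079188 (node 1097 3298153582 (node 1080 1540235411
  nil nil) nil) (node 1136 678834416 nil nil)) (node 1218 10063771172 (node 1198 4098127423 (node
  1164 400685545 nil nil) nil) (node 1232 90267565726 nil nil))) (node 1474 2025820402437 (node
  1378 4637296482 (node 1353 403834661897 (node 1319 13584146395 nil nil) nil) (node 1419 349244014
  nil nil)) (node 1540 733303844 (node 1523 394200573 (node 1520 380728192 nil nil) nil) (node 1554
  3727213438 nil nil)))) (node 2104 433579432 (node 1796 46734399465 (node 1700 404895465 (node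
  1675 12114671036 (node 1661 1807961322 nil nil) nil) (node 1762 2221611561 nil nil)) (node 1917
  209087410363 (node 1876 362485006 (node 1821 916323638 nil nil) nil) (node 1997 784554476 nil
  nil))) (node 2561 460213816 (node 2239 6394636981 (node 2205 489234043 (node 2118 2030494050 nil
  nil) nil) (node 2360 24320833589 nil nil)) (node 2803 3411261123 (node 2682 1126334261 nil nil)
  (node 3246 638738581 nil nil)))))

/-- The exact solution in degree `13` for `N = 13`, scaled to integers. -/
def table13 : Table :=
  node 1126 37494883426 (node 725 71059162954 (node 531 12299792089 (node 327 171144650319 (node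
  207 12282925844 (node 150 12270166636 (node 148 19786931346 nil nil) (node 172 12360570781 nil
  nil)) (node 303 421849617994 (node 231 8389893494 nil nil) nil)) (node 467 19688002464 (node 445
  35460682794 (node 386 72656544506 nil nil) nil) (node 490 8368592596 (node 482 14455562948281 nil
  nil) nil))) (node 637 3497559918198619 (node 591 8607385724 (node 570 8376387526 (node 541
  3980683894894 nil nil) (node 590 8370204206 nil nil)) (node 625 36107358154 (node 609 8366658664
  nil nil) nil)) (node 669 35568192154 (node 649 20187705984 (node 648 35198536516 nil nil) nil)
  (node 708 12414405731 (node 686 162797716731 nil nil) nil)))) (node 959 60369680405944 (node 829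
  21183358594 (node 770 39711792731 (node 746 81822553176 (node 728 19740912256 nil nil) (node 767
  8411415744 nil nil)) (node 824 1226881753006 (node 804 477494469556 nil nil) nil)) (node 910
  8593942136 (node 888 12823181306 (node 863 175059814969 nil nil) nil) (node 947 8444469964 (node
  925 1746580865169 nil nil) nil))) (node 1047 12369726694 (node 991 8416130284 (node 984
  549253144206 (node 970 8403988216 nil nil) nil) (node 1011 12279353254 (node 1008 19976189376 nil
  nil) nil)) (node 1091 12792630084 (node 1080 320125107897231 (node 1068 12922207116 nil nil) nil)
  (node 1112 12838499076 (node 1092 8668186826 nil nil) nil))))) (node 1632 9156820036 (node 1368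
  255417925581 (node 1213 13523777979 (node 1171 8600392344 (node 1146 74210671756 (node 1129
  38793428999 nil nil) (node 1168 20999279886 nil nil)) (node 1189 22633522254 (node 1185
  20337912544 nil nil) nil)) (node 1272 8877049506 (node 1267 198055493244 (node 1247 87868178754
  nil nil) nil) (node 1306 40230183981 (node 1281 1541985942994 nil nil) nil))) (node 1569
  13108724604 (node 1451 8639900594 (node 1427 97276902694 (node 1402 6511355356506 nil nil) (node
  1448 8499393136 nil nil)) (node 1523 31356802461719 (node 1468 12483177226 nil nil) nil)) (node
  1603 81275823904 (node 1589 21404376864 (node 1572 13413381111 nil nil) nil) (node 1628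
  8694519756 (node 1611 8853656474 nil nil) nil)))) (node 2153 14176854904 (node 1870 24798707206
  (node 1749 13602622669 (node 1710 43551198626 (node 1690 23356047936 nil nil) (node 1724
  230671073256 nil nil)) (node 1845 807548474444 (node 1811 50656771909 nil nil) nil)) (node 2032
  8913632156 (node 1966 3384305018731 (node 1925 12725199514 nil nil) nil) (node 2133 9254959414
  (node 2046 22289802756 nil nil) nil))) (node 2489 9041482064 (node 2288 126134438326 (node 2254
  15212447601 (node 2167 47223950174 nil nil) nil) (node 2409 426729597219 (node 2313 9526546494
  nil nil) nil)) (node 2852 70565844791 (node 2731 28457403264 (node 2610 14639697436 nil nil) nil)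
  (node 3295 17905626559 (node 3174 10082824466 nil nil) nil)))))

/-- The solution in degree `14` for `N = 14`, scaled and rounded to integers. -/
def table14 : Table :=
  node 1195 28 (node 735 69 (node 542 1 (node 352 203 (node 221 3 (node 197 6 (node 81 1 (node 18 1
  nil nil) nil) (node 199 3 nil nil)) (node 280 2 (node 256 3 nil nil) (node 339 1 nil nil))) (node
  516 6 (node 435 28 (node 376 75 nil nil) (node 494 12 nil nil)) (node 531 9486 (node 519 1 nil
  nil) (node 539 2 nil nil)))) (node 664 1 (node 639 2 (node 590 2376 (node 580 3 (node 563 1 nil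
  nil) nil) (node 619 2 nil nil)) (node 642 1 (node 640 2 nil nil) (node 658 2 nil nil))) (node 697
  12 (node 678 1 (node 674 12 nil nil) (node 686 3000000 nil nil)) (node 699 1 (node 698 6 nil nil)
  (node 718 12 nil nil))))) (node 1008 43377 (node 873 661 (node 816 2 (node 777 6 (node 774 27
  (node 757 3 nil nil) nil) (node 795 32 nil nil)) (node 838 1 (node 819 14 nil nil) (node 853 239
  nil nil))) (node 937 3 (node 912 77 (node 878 6 nil nil) (node 922 1 nil nil)) (node 974 1003
  (node 959 2 nil nil) (node 996 2 nil nil)))) (node 1099 1 (node 1040 2 (node 1023 1 (node 1020 1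
  (node 1019 2 nil nil) nil) (node 1033 281 nil nil)) (node 1060 3 (node 1057 6 nil nil) (node 1096
  3 nil nil))) (node 1141 2 (node 1129 251466 (node 1117 3 nil nil) (node 1140 3 nil nil)) (node
  1175 13 (node 1161 3 nil nil) (node 1178 13 nil nil)))))) (node 1705 1 (node 1497 2 (node 1321 2
  (node 1238 7 (node 1220 2 (node 1217 6 (node 1200 1 nil nil) nil) (node 1234 6 nil nil)) (node
  1296 36 (node 1262 4 nil nil) (node 1316 89 nil nil))) (node 1380 1 (node 1355 14 (node 1330 874
  nil nil) (node 1379 1 nil nil)) (node 1451 4169 (node 1417 123 nil nil) (node 1476 40 nil nil))))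
  (node 1604 1 (node 1556 1 (node 1517 3 (node 1503 1 (node 1500 2 nil nil) nil) (node 1539 1 nil
  nil)) (node 1572 22295 (node 1560 1 nil nil) (node 1583 1 nil nil))) (node 1652 32 (node 1621 4
  (node 1618 4 nil nil) (node 1638 6 nil nil)) (node 1677 2 (node 1660 2 nil nil) (node 1681 2 nil
  nil))))) (node 2216 18 (node 1974 3 (node 1860 19 (node 1773 109 (node 1759 16 (node 1739 7 nil
  nil) nil) (node 1798 4 nil nil)) (node 1919 8 (node 1894 447 nil nil) (node 1960 1 nil nil)))
  (node 2081 2 (node 2061 1 (node 2015 2134 nil nil) (node 2064 1 nil nil)) (node 2182 2 (node 2095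
  7 nil nil) (node 2202 4 nil nil)))) (node 2659 4 (node 2417 1 (node 2337 57 (node 2303 4 (node
  2241 1 nil nil) nil) (node 2362 2 nil nil)) (node 2538 2 (node 2458 230 nil nil) (node 2645 2 nil
  nil))) (node 3102 2 (node 2780 10 (node 2746 2 nil nil) (node 2901 30 nil nil)) (node 3344 6
  (node 3223 3 nil nil) (node 3787 2 nil nil))))))

/-- The solution in degree `15` for `N = 15`, scaled and rounded to integers. -/
def table15 : Table :=
  node 1227 4 (node 823 8 (node 580 4945 (node 401 80 (node 270 1 (node 248 1 (node 246 1 nil nil)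
  nil) (node 305 1 nil nil)) (node 543 3 (node 484 9 (node 425 27 nil nil) nil) (node 565 1 nil
  nil))) (node 746 3 (node 723 3 (node 639 1136 (node 629 1 nil nil) nil) (node 735 2000000 nil
  nil)) (node 784 25 (node 767 3 (node 747 1 nil nil) nil) (node 806 1 nil nil)))) (node 1057 24573
  (node 922 288 (node 868 4 (node 844 11 (node 826 1 nil nil) nil) (node 902 98 nil nil)) (node 986
  1 (node 961 28 (node 927 2 nil nil) nil) (node 1023 465 nil nil))) (node 1166 1 (node 1109 1
  (node 1106 1 (node 1082 117 nil nil) nil) (node 1145 1 nil nil)) (node 1210 1 (node 1189 1 (node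
  1178 154630 nil nil) nil) (node 1224 4 nil nil))))) (node 1808 5 (node 1466 49 (node 1311 1 (node
  1283 1 (node 1266 2 (node 1244 9 nil nil) nil) (node 1287 2 nil nil)) (node 1379 401 (node 1365
  33 (node 1345 12 nil nil) nil) (node 1404 4 nil nil))) (node 1667 1 (node 1566 1 (node 1525 14
  (node 1500 2132 nil nil) nil) (node 1621 12532 nil nil)) (node 1701 11 (node 1687 2 (node 1670 1
  nil nil) nil) (node 1788 2 nil nil)))) (node 2265 6 (node 1968 2 (node 1909 6 (node 1847 1 (node
  1822 43 nil nil) nil) (node 1943 202 nil nil)) (node 2144 2 (node 2064 1080 (node 2023 1 nil nil)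
  nil) (node 2251 1 nil nil))) (node 2708 1 (node 2411 1 (node 2386 22 (node 2352 1 nil nil) nil)
  (node 2507 102 nil nil)) (node 3272 1 (node 2950 11 (node 2829 3 nil nil) nil) (node 3393 2 nil
  nil)))))

/-- The solution in degree `16` for `N = 16`, scaled and rounded to integers. -/
def table16 : Table :=
  node 1315 1 (node 875 1 (node 688 1253 (node 533 7 (node 450 74 (node 295 1 nil nil) (node 474 23
  nil nil)) (node 614 1 (node 592 2 nil nil) (node 629 5908 nil nil))) (node 796 1 (node 784
  3000000 (node 772 2 nil nil) (node 795 2 nil nil)) (node 833 21 (node 816 2 nil nil) (node 872 6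
  nil nil)))) (node 1106 31705 (node 971 292 (node 917 3 (node 893 8 nil nil) (node 951 94 nil
  nil)) (node 1010 24 (node 976 1 nil nil) (node 1072 501 nil nil))) (node 1273 3 (node 1155 1
  (node 1131 115 nil nil) (node 1227 215242 nil nil)) (node 1293 7 (node 1276 3 nil nil) nil))))
  (node 1871 40 (node 1549 2511 (node 1414 29 (node 1336 1 (node 1332 1 nil nil) (node 1394 10 nil
  nil)) (node 1453 3 (node 1428 428 nil nil) (node 1515 47 nil nil))) (node 1750 9 (node 1670 16074
  (node 1574 12 nil nil) (node 1736 1 nil nil)) (node 1857 3 (node 1837 1 nil nil) nil))) (node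
  2401 1 (node 2113 1263 (node 1992 213 (node 1958 5 nil nil) (node 2017 2 nil nil)) (node 2300 1
  (node 2193 1 nil nil) (node 2314 4 nil nil))) (node 2878 2 (node 2556 106 (node 2435 20 nil nil)
  (node 2757 1 nil nil)) (node 3442 1 (node 2999 10 nil nil) nil))))

/-- The solution in degree `17` for `N = 17`, scaled and rounded to integers. -/
def table17 : Table :=
  node 1385 1 (node 942 5 (node 821 1 (node 641 1 (node 523 14 (node 499 48 nil nil) (node 582 4
  nil nil)) (node 737 943 (node 678 4781 nil nil) nil)) (node 865 1 (node 844 1 (node 833 3000000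
  nil nil) nil) (node 921 3 (node 882 12 nil nil) nil))) (node 1155 27560 (node 1020 204 (node 1000
  63 (node 966 1 nil nil) nil) (node 1121 370 (node 1059 15 nil nil) nil)) (node 1322 1 (node 1276
  200788 (node 1180 78 nil nil) nil) (node 1342 4 (node 1325 1 nil nil) nil)))) (node 1920 26 (node
  1598 2008 (node 1477 313 (node 1463 18 (node 1443 6 nil nil) nil) (node 1564 31 (node 1502 2 nil
  nil) nil)) (node 1799 5 (node 1719 13909 (node 1623 7 nil nil) nil) (node 1906 2 (node 1886 1 nil
  nil) nil))) (node 2363 2 (node 2066 1 (node 2041 155 (node 2007 3 nil nil) nil) (node 2242 1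
  (node 2162 1005 nil nil) nil)) (node 2927 1 (node 2605 77 (node 2484 13 nil nil) nil) (node 3491
  1 (node 3048 6 nil nil) nil))))

/-- The solution in degree `18` for `N = 18`, scaled and rounded to integers. -/
def table18 : Table :=
  node 1374 1 (node 970 2 (node 786 963 (node 631 3 (node 572 12 (node 548 42 nil nil) nil) (node
  727 5231 (node 690 1 nil nil) nil)) (node 893 1 (node 882 4000000 (node 870 1 nil nil) nil) (node
  931 10 (node 914 1 nil nil) nil))) (node 1170 372 (node 1049 58 (node 1015 1 (node 991 4 nil nil)
  nil) (node 1108 12 (node 1069 194 nil nil) nil)) (node 1325 250875 (node 1229 73 (node 1204 32234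
  nil nil) nil) (node 1371 1 nil nil)))) (node 1955 1 (node 1613 28 (node 1512 16 (node 1492 5
  (node 1391 3 nil nil) nil) (node 1551 1 (node 1526 313 nil nil) nil)) (node 1768 16212 (node 1672
  6 (node 1647 2177 nil nil) nil) (node 1848 4 nil nil))) (node 2412 2 (node 2090 154 (node 2056 2
  (node 1969 24 nil nil) nil) (node 2211 1086 (node 2115 1 nil nil) nil)) (node 2976 1 (node 2654
  76 (node 2533 12 nil nil) nil) (node 3097 6 nil nil))))

/-- The solution in degree `19` for `N = 19`, scaled and rounded to integers. -/
def table19 : Table :=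
  node 1440 2 (node 1064 1 (node 919 1 (node 680 2 (node 621 9 (node 597 36 nil nil) nil) (node 835
  938 (node 776 5432 nil nil) nil)) (node 1019 2 (node 980 8 (node 931 5000000 nil nil) nil) (node
  1040 3 nil nil))) (node 1253 35631 (node 1157 10 (node 1118 177 (node 1098 51 nil nil) nil) (node
  1219 358 nil nil)) (node 1420 1 (node 1374 295038 (node 1278 65 nil nil) nil) (node 1423 1 nil
  nil)))) (node 2004 1 (node 1662 25 (node 1575 299 (node 1561 13 (node 1541 4 nil nil) nil) (node
  1600 1 nil nil)) (node 1817 17872 (node 1721 5 (node 1696 2244 nil nil) nil) (node 1897 3 nil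
  nil))) (node 2461 2 (node 2139 147 (node 2105 2 (node 2018 21 nil nil) nil) (node 2260 1117 nil
  nil)) (node 3025 1 (node 2703 72 (node 2582 10 nil nil) nil) (node 3146 5 nil nil))))

/-- The solution in degree `20` for `N = 20`, scaled and rounded to integers. -/
def table20 : Table :=
  node 1590 3 (node 1113 1 (node 884 890 (node 729 2 (node 670 8 (node 646 30 nil nil) nil) (node
  825 5473 nil nil)) (node 1068 1 (node 1029 6 (node 980 6000000 nil nil) nil) (node 1089 2 nil
  nil))) (node 1302 38079 (node 1206 8 (node 1167 158 (node 1147 45 nil nil) nil) (node 1268 336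
  nil nil)) (node 1423 334271 (node 1327 57 nil nil) (node 1489 2 nil nil)))) (node 2067 18 (node
  1745 2247 (node 1649 1 (node 1624 280 (node 1610 11 nil nil) nil) (node 1711 22 nil nil)) (node
  1946 3 (node 1866 19059 (node 1770 4 nil nil) nil) (node 2053 1 nil nil))) (node 2631 9 (node
  2309 1116 (node 2188 137 (node 2154 1 nil nil) nil) (node 2510 1 nil nil)) (node 3074 1 (node
  2752 67 nil nil) (node 3195 4 nil nil))))

end Tables

/-! ### Verification of the tables in the kernel -/

theorem verify_table1 : table1.verify 1 0 1 = true := by decide +kernel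

theorem verify_table2 : table2.verify 2 0 2 = true := by decide +kernel

theorem verify_table2At13 : table2At13.verify 13 0 2 = true := by decide +kernel

theorem verify_table3 : table3.verify 3 0 3 = true := by decide +kernel

theorem verify_table3At13 : table3At13.verify 13 0 3 = true := by decide +kernel

theorem verify_table4 : table4.verify 4 0 4 = true := by decide +kernel

theorem verify_table4At13 : table4At13.verify 13 0 4 = true := by decide +kernel

theorem verify_table5 : table5.verify 5 0 5 = true := by decide +kernel

theorem verify_table5At13 : table5At13.verify 13 0 5 = true := by decide +kernel

theorem verify_table6 : table6.verify 6 0 6 = true := by decide +kernel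

theorem verify_table6At13 : table6At13.verify 13 0 6 = true := by decide +kernel

theorem verify_table7 : table7.verify 7 0 7 = true := by decide +kernel

theorem verify_table7At13 : table7At13.verify 13 0 7 = true := by decide +kernel

theorem verify_table8 : table8.verify 8 0 8 = true := by decide +kernel

theorem verify_table8At13 : table8At13.verify 13 0 8 = true := by decide +kernel

theorem verify_table9 : table9.verify 9 0 9 = true := by decide +kernel

theorem verify_table9At13 : table9At13.verify 13 0 9 = true := by decide +kernel

theorem verify_table10 : table10.verify 10 0 10 = true := by decide +kernel

theorem verify_table10At13 : table10At13.verify 13 0 10 = true := by decide +kernel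

theorem verify_table11 : table11.verify 11 0 11 = true := by decide +kernel

theorem verify_table11At13 : table11At13.verify 13 0 11 = true := by decide +kernel

theorem verify_table12 : table12.verify 12 0 12 = true := by decide +kernel

theorem verify_table12At13 : table12At13.verify 13 0 12 = true := by decide +kernel

theorem verify_table13 : table13.verify 13 0 13 = true := by decide +kernel

theorem verify_table14 : table14.verify 14 10 14 = true := by decide +kernel

theorem verify_table15 : table15.verify 15 11 15 = true := by decide +kernel

theorem verify_table16 : table16.verify 16 11 16 = true := by decide +kernel

theorem verify_table17 : table17.verify 17 13 17 = true := by decide +kernel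

theorem verify_table18 : table18.verify 18 13 18 = true := by decide +kernel

theorem verify_table19 : table19.verify 19 11 19 = true := by decide +kernel

theorem verify_table20 : table20.verify 20 16 20 = true := by decide +kernel

/-! ### Comparison of the values `M_α(1/d)` -/

theorem abs_M_sub_le {T : Table} {ε d : ℕ} (hd : 1 ≤ d) (h : T.verify d ε d = true)
    (α : Nat.Partition d) :
    |M α (1 / (d : ℝ)) * T.eval (Multiset.replicate d 1) - walkGF d d 1 * T.eval α.parts| ≤
      ε * walkGF d d 1 := by
  obtain ⟨n, rfl⟩ := Nat.exists_eq_add_of_le' hd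
  obtain ⟨σ, hσ⟩ := exists_hasType α
  rw [M_eq_walkGF hσ, ← show σ.partition.parts = α.parts from hσ]
  exact abs_walkGF_sub_le_of_verify (Nat.lt_succ_self n) h σ

theorem M_lt_of_eval_lt {T : Table} {ε d : ℕ} (hd : 1 ≤ d) (h : T.verify d ε d = true)
    {α β : Nat.Partition d} (hlt : T.eval β.parts + 2 * ε < T.eval α.parts) :
    M β (1 / (d : ℝ)) < M α (1 / (d : ℝ)) := by
  have hα := (abs_le.mp (abs_M_sub_le hd h α)).1
  have hβ := (abs_le.mp (abs_M_sub_le hd h β)).2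
  have hw : 0 < walkGF d d 1 := walkGF_one_pos le_rfl
  have hV : (0 : ℝ) < T.eval (Multiset.replicate d 1) := by exact_mod_cast Table.eval_one_pos h
  have hlt' : (T.eval β.parts : ℝ) + 2 * ε < T.eval α.parts := by exact_mod_cast hlt
  have := mul_lt_mul_of_pos_left hlt' hw
  exact lt_of_mul_lt_mul_right (by linarith) hV.le

theorem M_le_of_eval_le {T : Table} {ε d : ℕ} (hd : 1 ≤ d) (h : T.verify d ε d = true)
    {α β : Nat.Partition d} (hle : T.eval β.parts + 2 * ε ≤ T.eval α.parts) :
    M β (1 / (d : ℝ)) ≤ M α (1 / (d : ℝ)) := by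
  have hα := (abs_le.mp (abs_M_sub_le hd h α)).1
  have hβ := (abs_le.mp (abs_M_sub_le hd h β)).2
  have hw : 0 < walkGF d d 1 := walkGF_one_pos le_rfl
  have hV : (0 : ℝ) < T.eval (Multiset.replicate d 1) := by exact_mod_cast Table.eval_one_pos h
  have hle' : (T.eval β.parts : ℝ) + 2 * ε ≤ T.eval α.parts := by exact_mod_cast hle
  have := mul_le_mul_of_nonneg_left hle' hw.le
  exact le_of_mul_le_mul_right (by linarith) hV

/-! ### The lexicographic order -/

/-- Comparison of lists in the lexicographic order. -/
def lexLT : List ℕ → List ℕ → Bool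
  | _, [] => false
  | [], _ :: _ => true
  | a :: l, b :: m => Nat.blt a b || (Nat.beq a b && lexLT l m)

theorem lexLT_iff (l m : List ℕ) : lexLT l m = true ↔ List.Lex (· < ·) l m := by
  induction l generalizing m with
  | nil => cases m <;> simp [lexLT]
  | cons a l ih => cases m with
    | nil => simp [lexLT]
    | cons b m =>
      rw [lexLT, Bool.or_eq_true, Bool.and_eq_true, Nat.beq_eq, ih, Nat.blt, Nat.ble_eq]
      constructor
      · rintro (h | ⟨rfl, h⟩)
        · exact .rel h
        · exact .cons h
      · rintro (_ | h | h)
        · exact Or.inl h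
        · exact Or.inr ⟨rfl, h⟩

/-- The partitions of `d` as weakly increasing lists. -/
def ascendingPartitions (d : ℕ) : List (List ℕ) := (partitionList d).map List.reverse

theorem sort_mem_ascendingPartitions {d : ℕ} (α : Nat.Partition d) :
    α.parts.sort (· ≤ ·) ∈ ascendingPartitions d := by
  refine List.mem_map.mpr ⟨(α.parts.sort (· ≤ ·)).reverse, mem_partitionList ?_ ?_ ?_,
    List.reverse_reverse _⟩
  · exact List.pairwise_reverse.mpr (Multiset.pairwise_sort _ _)
  · intro j hj
    exact α.parts_pos (by simpa using hj)
  · rw [List.sum_reverse, ← Multiset.sum_coe, Multiset.sort_eq, α.parts_sum]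

theorem get_keySum_sort {d : ℕ} (T : Table) (α : Nat.Partition d) :
    T.get (keySum (α.parts.sort (· ≤ ·))) = T.eval α.parts := by
  rw [keySum_eq, Multiset.sort_eq, Table.eval]

theorem precedes_iff {d : ℕ} {α β : Nat.Partition d} :
    Precedes α β ↔ lexLT (α.parts.sort (· ≤ ·)) (β.parts.sort (· ≤ ·)) = true :=
  (lexLT_iff _ _).symm

/-- The values of `T` decrease strictly in the lexicographic order on the partitions of `d`. -/
def Table.decreasing (T : Table) (d : ℕ) : Bool :=
  (ascendingPartitions d).all fun a => (ascendingPartitions d).all fun b =>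
    !lexLT a b || Nat.blt (T.get (keySum b)) (T.get (keySum a))

theorem monotonicityConjecture_of_decreasing {T : Table} {d : ℕ} (hd : 1 ≤ d)
    (h : T.verify d 0 d = true) (hT : T.decreasing d = true) : MonotonicityConjecture d := by
  intro α β hαβ
  rw [Table.decreasing, List.all_eq_true] at hT
  have h1 := List.all_eq_true.mp (hT _ (sort_mem_ascendingPartitions α)) _
    (sort_mem_ascendingPartitions β)
  rw [precedes_iff.mp hαβ, get_keySum_sort, get_keySum_sort] at h1
  exact M_lt_of_eval_lt hd h (Nat.le_of_ble_eq_true h1)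

/-- The list `c` is a partition of `d`, written in weakly increasing order. -/
def IsAscendingPartition (d : ℕ) (c : List ℕ) : Prop :=
  c.Pairwise (· ≤ ·) ∧ (∀ j ∈ c, 0 < j) ∧ c.sum = d

instance (d : ℕ) (c : List ℕ) : Decidable (IsAscendingPartition d c) :=
  inferInstanceAs (Decidable (_ ∧ _ ∧ _))

/-- Among the pairs of consecutive partitions of `d`, only `(a₀, b₀)` can violate the strict
decrease of the values of `T`. -/
def Table.decreasingExcept (T : Table) (d : ℕ) (a₀ b₀ : List ℕ) : Bool :=
  (ascendingPartitions d).all fun a => (ascendingPartitions d).all fun b =>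
    !lexLT a b || Nat.blt (T.get (keySum b)) (T.get (keySum a)) || (a == a₀ && b == b₀) ||
      (ascendingPartitions d).any fun c =>
        lexLT a c && lexLT c b && decide (IsAscendingPartition d c)

/-- No partition of `d` lies strictly between `a` and `b` in the lexicographic order. -/
def noneBetween (d : ℕ) (a b : List ℕ) : Bool :=
  (ascendingPartitions d).all fun c => !(lexLT a c && lexLT c b)

theorem sort_eq_of_pairwise {s : Multiset ℕ} {l : List ℕ} (hs : s = l)
    (hl : l.Pairwise (· ≤ ·)) : s.sort (· ≤ ·) = l :=
  List.Perm.eq_of_pairwise (fun _ _ _ _ => le_antisymm) (Multiset.pairwise_sort _ _) hl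
    (Multiset.coe_eq_coe.mp ((Multiset.sort_eq _ _).trans hs))

theorem sort_partOneSixSeven :
    partOneSixSeven.parts.sort (· ≤ ·) = [1, 1, 1, 1, 1, 1, 7] :=
  sort_eq_of_pairwise rfl (by decide)

theorem sort_partOneFiveTwoFour :
    partOneFiveTwoFour.parts.sort (· ≤ ·) = [1, 1, 1, 1, 1, 2, 2, 2, 2] :=
  sort_eq_of_pairwise rfl (by decide)

theorem isSuccessor_partOneSixSeven : IsSuccessor partOneSixSeven partOneFiveTwoFour := by
  have hnone : noneBetween 13 [1, 1, 1, 1, 1, 1, 7] [1, 1, 1, 1, 1, 2, 2, 2, 2] = true := by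
    decide +kernel
  constructor
  · rw [precedes_iff, sort_partOneSixSeven, sort_partOneFiveTwoFour]
    rfl
  · rintro γ ⟨h1, h2⟩
    rw [precedes_iff, sort_partOneSixSeven] at h1
    rw [precedes_iff, sort_partOneFiveTwoFour] at h2
    have h := List.all_eq_true.mp hnone _ (sort_mem_ascendingPartitions γ)
    rw [h1, h2] at h
    exact absurd h (by decide)

theorem eq_of_isSuccessor_of_not_lt {α β : Nat.Partition 13} (hs : IsSuccessor α β)
    (hlt : ¬ M β (1 / 13) < M α (1 / 13)) : α = partOneSixSeven ∧ β = partOneFiveTwoFour := by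
  have hT : table13.decreasingExcept 13 [1, 1, 1, 1, 1, 1, 7] [1, 1, 1, 1, 1, 2, 2, 2, 2] =
      true := by
    decide +kernel
  rw [Table.decreasingExcept, List.all_eq_true] at hT
  have h := List.all_eq_true.mp (hT _ (sort_mem_ascendingPartitions α)) _
    (sort_mem_ascendingPartitions β)
  rw [precedes_iff.mp hs.1, get_keySum_sort, get_keySum_sort, Bool.or_eq_true, Bool.or_eq_true]
    at h
  rcases h with (h | h) | h
  · exact absurd (M_lt_of_eval_lt (by norm_num) verify_table13 (Nat.le_of_ble_eq_true h))
      (by simpa using hlt)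
  · rw [Bool.and_eq_true, beq_iff_eq, beq_iff_eq, ← sort_partOneSixSeven,
      ← sort_partOneFiveTwoFour] at h
    refine ⟨Nat.Partition.ext ?_, Nat.Partition.ext ?_⟩
    · rw [← Multiset.sort_eq α.parts (· ≤ ·), h.1, Multiset.sort_eq]
    · rw [← Multiset.sort_eq β.parts (· ≤ ·), h.2, Multiset.sort_eq]
  · obtain ⟨c, _, hc⟩ := List.any_eq_true.mp h
    rw [Bool.and_eq_true, Bool.and_eq_true, decide_eq_true_eq] at hc
    obtain ⟨⟨h1, h2⟩, hsort, hpos, hsum⟩ := hc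
    let γ : Nat.Partition 13 := ⟨c, fun {j} hj => hpos j hj, hsum⟩
    have hγ : γ.parts.sort (· ≤ ·) = c := sort_eq_of_pairwise rfl hsort
    refine absurd ⟨?_, ?_⟩ (hs.2 γ)
    · rwa [precedes_iff, hγ]
    · rwa [precedes_iff, hγ]

/-! ### The violating pair -/

/-- The partition `(1^(n+1), 7)` of `n + 8`. -/
def partOnesSeven (n : ℕ) : Nat.Partition (n + 8) where
  parts := Multiset.replicate (n + 1) 1 + {7}
  parts_pos := by
    intro i hi
    rw [Multiset.mem_add, Multiset.mem_replicate, Multiset.mem_singleton] at hi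
    omega
  parts_sum := by
    rw [Multiset.sum_add, Multiset.sum_replicate, Multiset.sum_singleton, smul_eq_mul, mul_one]

/-- The partition `(1^n, 2^4)` of `n + 8`. -/
def partOnesTwos (n : ℕ) : Nat.Partition (n + 8) where
  parts := Multiset.replicate n 1 + Multiset.replicate 4 2
  parts_pos := by
    intro i hi
    rw [Multiset.mem_add, Multiset.mem_replicate, Multiset.mem_replicate] at hi
    omega
  parts_sum := by
    rw [Multiset.sum_add, Multiset.sum_replicate, Multiset.sum_replicate, smul_eq_mul, mul_one,
      smul_eq_mul]

theorem precedes_partOnesSeven (n : ℕ) : Precedes (partOnesSeven n) (partOnesTwos n) := by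
  have h1 : (partOnesSeven n).parts.sort (· ≤ ·) = List.replicate n 1 ++ [1, 7] := by
    refine sort_eq_of_pairwise ?_ ?_
    · change Multiset.replicate (n + 1) 1 + {7} = _
      rw [Multiset.replicate_succ, ← Multiset.coe_add, Multiset.coe_replicate,
        Multiset.cons_add, ← Multiset.add_cons]
      rfl
    · simp [List.pairwise_append, List.pairwise_replicate]
  have h2 : (partOnesTwos n).parts.sort (· ≤ ·) = List.replicate n 1 ++ [2, 2, 2, 2] := by
    refine sort_eq_of_pairwise ?_ ?_
    · change Multiset.replicate n 1 + Multiset.replicate 4 2 = _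
      rw [← Multiset.coe_add, Multiset.coe_replicate]
      rfl
    · simp [List.pairwise_append, List.pairwise_replicate]
  rw [Precedes, h1, h2]
  clear h1 h2
  induction n with
  | zero => exact .rel (by norm_num)
  | succ n ih => exact .cons ih

theorem eval_partOnesSeven (T : Table) (n : ℕ) :
    T.eval (partOnesSeven n).parts = T.get ((n + 1) * 49 + partWeight 7) := by
  rw [Table.eval, partOnesSeven, Multiset.map_add, Multiset.sum_add, Multiset.map_replicate,
    Multiset.sum_replicate, Multiset.map_singleton, Multiset.sum_singleton]
  rfl

theorem eval_partOnesTwos (T : Table) (n : ℕ) :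
    T.eval (partOnesTwos n).parts = T.get (n * 49 + 4 * partWeight 2) := by
  rw [Table.eval, partOnesTwos, Multiset.map_add, Multiset.sum_add, Multiset.map_replicate,
    Multiset.sum_replicate, Multiset.map_replicate, Multiset.sum_replicate]
  rfl

theorem not_monotonicityConjecture {T : Table} {ε n : ℕ} (h : T.verify (n + 8) ε (n + 8) = true)
    (hT : Nat.ble (T.get ((n + 1) * 49 + partWeight 7) + 2 * ε)
      (T.get (n * 49 + 4 * partWeight 2)) = true) :
    ¬ MonotonicityConjecture (n + 8) := by
  intro hconj
  refine (hconj _ _ (precedes_partOnesSeven n)).not_ge (M_le_of_eval_le (by omega) h ?_)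
  rw [eval_partOnesSeven, eval_partOnesTwos]
  exact Nat.le_of_ble_eq_true hT

theorem not_monotonicityConjecture_of_mem_Icc {d : ℕ} (h1 : 13 ≤ d) (h2 : d ≤ 20) :
    ¬ MonotonicityConjecture d := by
  interval_cases d
  · exact not_monotonicityConjecture (n := 5) verify_table13 (by decide +kernel)
  · exact not_monotonicityConjecture (n := 6) verify_table14 (by decide +kernel)
  · exact not_monotonicityConjecture (n := 7) verify_table15 (by decide +kernel)
  · exact not_monotonicityConjecture (n := 8) verify_table16 (by decide +kernel)
  · exact not_monotonicityConjecture (n := 9) verify_table17 (by decide +kernel)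
  · exact not_monotonicityConjecture (n := 10) verify_table18 (by decide +kernel)
  · exact not_monotonicityConjecture (n := 11) verify_table19 (by decide +kernel)
  · exact not_monotonicityConjecture (n := 12) verify_table20 (by decide +kernel)

theorem monotonicityConjecture_of_lt {d : ℕ} (h1 : 1 ≤ d) (h2 : d < 13) :
    MonotonicityConjecture d := by
  interval_cases d
  · exact monotonicityConjecture_of_decreasing h1 verify_table1 (by decide +kernel)
  · exact monotonicityConjecture_of_decreasing h1 verify_table2 (by decide +kernel)
  · exact monotonicityConjecture_of_decreasing h1 verify_table3 (by decide +kernel)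
  · exact monotonicityConjecture_of_decreasing h1 verify_table4 (by decide +kernel)
  · exact monotonicityConjecture_of_decreasing h1 verify_table5 (by decide +kernel)
  · exact monotonicityConjecture_of_decreasing h1 verify_table6 (by decide +kernel)
  · exact monotonicityConjecture_of_decreasing h1 verify_table7 (by decide +kernel)
  · exact monotonicityConjecture_of_decreasing h1 verify_table8 (by decide +kernel)
  · exact monotonicityConjecture_of_decreasing h1 verify_table9 (by decide +kernel)
  · exact monotonicityConjecture_of_decreasing h1 verify_table10 (by decide +kernel)
  · exact monotonicityConjecture_of_decreasing h1 verify_table11 (by decide +kernel)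
  · exact monotonicityConjecture_of_decreasing h1 verify_table12 (by decide +kernel)

/-! ### Exact values in degree `13` -/

/-- The recursion for the value at the identity, which fixes the scale of the solutions of the
linear system, in terms of the entries `v₁` and `v₂` of an exact table at the identity and at a
transposition. -/
theorem walkGF_succ_one_mul {T : Table} {N n : ℕ} (hn : n < N) (h0 : n ≠ 0)
    (h : T.verify N 0 (n + 1) = true) {v₁ v₂ : ℕ} (h1 : T.get ((n + 1) * 49) = v₁)
    (h2 : T.get ((n - 1) * 49 + partWeight 2) = v₂) :
    walkGF N (n + 1) 1 * (N * v₁ - n * v₂) = N * v₁ * walkGF N n 1 := by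
  have hne : (0 : Fin (n + 1)) ≠ Fin.last n := fun h => h0 (by simpa [Fin.ext_iff] using h.symm)
  have hparts := parts_partition_swap hne
  have hsys := walkGF_succ_one hn hparts
  have hT := abs_walkGF_sub_le_of_verify hn h (swap 0 (Fin.last n))
  have heval : T.eval (2 ::ₘ Multiset.replicate (n - 1) 1) = v₂ := by
    rw [← h2, Table.eval, Multiset.map_cons, Multiset.sum_cons, Multiset.map_replicate,
      Multiset.sum_replicate, add_comm]
    rfl
  rw [Nat.cast_zero, zero_mul, abs_nonpos_iff, sub_eq_zero, eval_replicate_one, h1, hparts,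
    heval] at hT
  linear_combination (v₁ : ℝ) * hsys + (n : ℝ) * hT

theorem walkGF_thirteen_one :
    walkGF 13 13 1 = 68881190782053346310650933 / 40567780113327194112000000 := by
  have h1 : walkGF 13 1 1 = 1 := by
    have h := walkGF_succ (N := 13) (k := 0) (by norm_num) 1
    rw [walkGF_zero_one] at h
    norm_num at h
    linarith
  have h2 : walkGF 13 2 1 = 169 / 168 := by
    have h := walkGF_succ_one_mul (by norm_num) (by norm_num) verify_table2At13
      (v₁ := 13) (v₂ := 1) (by decide +kernel) (by decide +kernel)
    norm_num [h1] at h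
    linarith
  have h3 : walkGF 13 3 1 = 28223 / 27720 := by
    have h := walkGF_succ_one_mul (by norm_num) (by norm_num) verify_table3At13
      (v₁ := 167) (v₂ := 13) (by decide +kernel) (by decide +kernel)
    norm_num [h2] at h
    linarith
  have h4 : walkGF 13 4 1 = 919867 / 887040 := by
    have h := walkGF_succ_one_mul (by norm_num) (by norm_num) verify_table4At13
      (v₁ := 5443) (v₂ := 429) (by decide +kernel) (by decide +kernel)
    norm_num [h3] at h
    linarith
  have h5 : walkGF 13 5 1 = 721422299 / 678585600 := by
    have h := walkGF_succ_one_mul (by norm_num) (by norm_num) verify_table5At13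
      (v₁ := 328367) (v₂ := 26219) (by decide +kernel) (by decide +kernel)
    norm_num [h4] at h
    linarith
  have h6 : walkGF 13 6 1 = 20848873097 / 19000396800 := by
    have h := walkGF_succ_one_mul (by norm_num) (by norm_num) verify_table6At13
      (v₁ := 4379862) (v₂ := 354510) (by decide +kernel) (by decide +kernel)
    norm_num [h5] at h
    linarith
  have h7 : walkGF 13 7 1 = 411731634509 / 361007539200 := by
    have h := walkGF_succ_one_mul (by norm_num) (by norm_num) verify_table7At13
      (v₁ := 6653478) (v₂ := 546306) (by decide +kernel) (by decide +kernel)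
    norm_num [h6] at h
    linarith
  have h8 : walkGF 13 8 1 = 50580184605899 / 42358217932800 := by
    have h := walkGF_succ_one_mul (by norm_num) (by norm_num) verify_table8At13
      (v₁ := 1414666485) (v₂ := 117926055) (by decide +kernel) (by decide +kernel)
    norm_num [h7] at h
    linarith
  have h9 : walkGF 13 9 1 = 453842414040585323 / 360256643518464000 := by
    have h := walkGF_succ_one_mul (by norm_num) (by norm_num) verify_table9At13
      (v₁ := 94025351747) (v₂ := 7964715187) (by decide +kernel) (by decide +kernel)
    norm_num [h8] at h
    linarith
  have h10 : walkGF 13 10 1 = 9652699443462784033 / 7205132870369280000 := by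
    have h := walkGF_succ_one_mul (by norm_num) (by norm_num) verify_table10At13
      (v₁ := 615326060596) (v₂ := 53023405332) (by decide +kernel) (by decide +kernel)
    norm_num [h9] at h
    linarith
  have h11 : walkGF 13 11 1 = 714260788655556508327 / 497154168055480320000 := by
    have h := walkGF_succ_one_mul (by norm_num) (by norm_num) verify_table11At13
      (v₁ := 3502434174748) (v₂ := 307414609060) (by decide +kernel) (by decide +kernel)
    norm_num [h10] at h
    linarith
  have h12 : walkGF 13 12 1 = 2522463642300802870396129 / 1622711204533087764480000 := by
    have h := walkGF_succ_one_mul (by norm_num) (by norm_num) verify_table12At13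
      (v₁ := 237867300810373) (v₂ := 21298965812771) (by decide +kernel) (by decide +kernel)
    norm_num [h11] at h
    linarith
  have h13 : walkGF 13 13 1 = 68881190782053346310650933 / 40567780113327194112000000 := by
    have h := walkGF_succ_one_mul (by norm_num) (by norm_num) verify_table13
      (v₁ := 3497559918198619) (v₂ := 320125107897231) (by decide +kernel) (by decide +kernel)
    norm_num [h12] at h
    linarith
  exact h13

theorem M_thirteen_mul (α : Nat.Partition 13) :
    M α (1 / 13) * 3497559918198619 = walkGF 13 13 1 * table13.eval α.parts := by
  have h := abs_M_sub_le (by norm_num) verify_table13 α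
  rw [Nat.cast_zero, zero_mul, abs_nonpos_iff, sub_eq_zero, eval_replicate_one,
    show table13.get (13 * 49) = 3497559918198619 by decide +kernel] at h
  exact_mod_cast h

theorem M_partOneSixSeven : M partOneSixSeven (1 / 13) =
    (13 : ℝ) ^ 13 / (Nat.factorial 13 : ℝ) ^ 2 * (30132115571 / 1149266300) := by
  have h := M_thirteen_mul partOneSixSeven
  rw [show table13.eval partOneSixSeven.parts = 421849617994 by
    rw [← get_keySum_sort, sort_partOneSixSeven]; decide +kernel, walkGF_thirteen_one] at h
  norm_num [Nat.factorial] at h ⊢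
  linarith

theorem M_partOneFiveTwoFour : M partOneFiveTwoFour (1 / 13) =
    (13 : ℝ) ^ 13 / (Nat.factorial 13 : ℝ) ^ 2 * (426729597219 / 16089728200) := by
  have h := M_thirteen_mul partOneFiveTwoFour
  rw [show table13.eval partOneFiveTwoFour.parts = 426729597219 by
    rw [← get_keySum_sort, sort_partOneFiveTwoFour]; decide +kernel, walkGF_thirteen_one] at h
  norm_num [Nat.factorial] at h ⊢
  linarith

end Procesi

theorem mainTheorem1 :
    -- the numbers `m^r(α)` are well defined
    (∀ (d r : ℕ) (α : Nat.Partition d) (ρ σ : Equiv.Perm (Fin d)),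
      Procesi.HasType (ρ⁻¹ * σ) α → Procesi.numMonotoneWalks r ρ σ = Procesi.m r α) ∧
    -- the series defining `M_α(1/d)` converges
    (∀ (d : ℕ) (α : Nat.Partition d), 1 ≤ d →
      Summable fun r : ℕ => (Procesi.m r α : ℝ) * (1 / (d : ℝ)) ^ r) ∧
    -- the conjecture is false
    (¬ ∀ d : ℕ, 1 ≤ d → Procesi.MonotonicityConjecture d) ∧
    -- the violating pair in degree 13
    Procesi.IsSuccessor Procesi.partOneSixSeven Procesi.partOneFiveTwoFour ∧
    Procesi.M Procesi.partOneSixSeven (1 / 13) =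
      (13 : ℝ) ^ 13 / (Nat.factorial 13 : ℝ) ^ 2 * (30132115571 / 1149266300) ∧
    Procesi.M Procesi.partOneFiveTwoFour (1 / 13) =
      (13 : ℝ) ^ 13 / (Nat.factorial 13 : ℝ) ^ 2 * (426729597219 / 16089728200) ∧
    Procesi.M Procesi.partOneSixSeven (1 / 13) < Procesi.M Procesi.partOneFiveTwoFour (1 / 13) ∧
    -- 13 is the first degree in which the conjecture fails
    (∀ d : ℕ, 1 ≤ d → d < 13 → Procesi.MonotonicityConjecture d) ∧
    -- the violating consecutive pair in degree 13 is unique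
    (∀ α β : Nat.Partition 13, Procesi.IsSuccessor α β →
      ¬ Procesi.M β (1 / 13) < Procesi.M α (1 / 13) →
      α = Procesi.partOneSixSeven ∧ β = Procesi.partOneFiveTwoFour) ∧
    -- the conjecture fails in all degrees from 13 to 20
    (∀ d : ℕ, 13 ≤ d → d ≤ 20 → ¬ Procesi.MonotonicityConjecture d) := by
  refine ⟨fun d r α ρ σ h => Procesi.numMonotoneWalks_eq_m r h,
    fun d α _ => Procesi.summable_m α,
    fun h => Procesi.not_monotonicityConjecture_of_mem_Icc le_rfl (by norm_num)
      (h 13 (by norm_num)),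
    Procesi.isSuccessor_partOneSixSeven, Procesi.M_partOneSixSeven, Procesi.M_partOneFiveTwoFour,
    ?_, fun d h1 h2 => Procesi.monotonicityConjecture_of_lt h1 h2,
    fun α β hs hlt => Procesi.eq_of_isSuccessor_of_not_lt hs hlt,
    fun d h1 h2 => Procesi.not_monotonicityConjecture_of_mem_Icc h1 h2⟩
  rw [Procesi.M_partOneSixSeven, Procesi.M_partOneFiveTwoFour]
  refine mul_lt_mul_of_pos_left (by norm_num) (by positivity)
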